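/- **Setting.** Let $(\mathsf Z,\mathcal Z)$ be a measurable space and $\mathrm Q$ a Markov kernel on it with unique invariant probability measure $\pi$. Assume that $\mathrm Q$ is uniformly geometrically ergodic with mixing time $\tau\in\{1,2,\dots\}$: for every $k\in\mathbb N$, $$\sup_{z,z'\in\mathsf Z}\tfrac12\|\mathrm Q^k(z,\cdot)-\mathrm Q^k(z',\cdot)\|_{\mathsf{TV}}\le (1/4)^{\lfloor k/\tau\rfloor}.$$ Let $(Z_i)_{i\ge0}$ be a stationary Markov chain with kernel $\mathrm Q$ (so $Z_0\sim\pi$). Let $F:\mathbb R^d\times\mathsf Z\to\mathbb R$ be differentiable in its first argument and $\pi$-integrable in the second, write $\nabla F(x,z)$ for the gradient in $x$, and put $f(x)=\mathbb E_{Z\sim\pi}[F(x,Z)]$. Assume that for some $L>0$ and $\sigma,\delta\in\mathbb R$: * $f$ is differentiable and $\|\nabla f(x)-\nabla f(y)\|\le L\|x-y\|$ for all $x,y\in\mathbb R^d$ (no convexity is assumed); * $\mathbb E_{\pi}[\nabla F(x,Z)]=\nabla f(x)$ and $\|\nabla F(x,z)-\nabla f(x)\|^2\le\sigma^2+\delta^2\|\nabla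 f(x)\|^2$ for all $x\in\mathbb R^d$, $z\in\mathsf Z$; * $f$ attains its global minimum, with value $f^*$. **Algorithm (randomized-batch SGD).** Given $x^0\in\mathbb R^d$, a step size $\gamma>0$, a real $M\ge2$, an integer $B\ge1$ and $T^0=0$, for $k=0,1,2,\dots$ sample $J_k$ with $\mathbb P(J_k=i)=2^{-i}$, $i=1,2,\dots$ (the $J_k$ are i.i.d. and independent of the chain), and set $$g^k_j=\frac1{2^jB}\sum_{i=1}^{2^jB}\nabla F(x^k,Z_{T^k+i}),\qquad g^k=g^k_0+\begin{cases}2^{J_k}\,(g^k_{J_k}-g^k_{J_k-1}),&2^{J_k}\le M,\\0,&\text{otherwise,}\end{cases}$$ $$x^{k+1}=x^k-\gamma g^k,\qquad T^{k+1}=T^k+2^{J_k}B.$$ **Theorem.** (i) For every $\kappa\ge1$ there are constants $c,C>0$, depending only on $\kappa$, such that in every such setting, for all integers $N,b\ge1$ and all real $\gamma>0$, $M\ge2$ with $$\gamma\le c\,\Bigl(L\bigl[1+\delta^2\tau b^{-1}+\delta^2\tau^2b^{-2}\bigr]\Bigr)^{-1},\qquad \kappa^{-1}\max\{2,\sqrt{1/(\gamma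 L)}\}\le M\le\kappa\max\{2,\sqrt{1/(\gamma L)}\},$$ the algorithm with $B=\lceil b\log_2M\rceil$ satisfies $$\mathbb E\Bigl[\frac1N\sum_{k=0}^{N-1}\|\nabla f(x^k)\|^2\Bigr]\le C\Bigl(\frac{f(x^0)-f^*}{\gamma N}+L\gamma\bigl[\sigma^2\tau b^{-1}+\sigma^2\tau^2b^{-2}\bigr]\Bigr),$$ the expectation being finite. (ii) Let $C_1=16\,(1+1/\ln^24)$ and $C_2=256/3$. There is an absolute constant $C>0$ such that the same conclusion holds in every such setting, for all integers $N,b\ge1$, whenever $$0<\gamma\le\Bigl[4L\bigl(1+4\bigl[C_1\tau b^{-1}+(C_1+1)\tau^2b^{-2}\bigr]\delta^2\bigr)\Bigr]^{-1},\qquad M=\max\{2,\sqrt{C_2/(\gamma L)}\},\qquad B=\lceil b\log_2M\rceil.$$ -/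

import Mathlib

open MeasureTheory ProbabilityTheory
open scoped ENNReal

universe u v

noncomputable section

/-- `f` is differentiable with `L`-Lipschitz gradient. -/
def LSmooth {d : ℕ} (L : ℝ) (f : EuclideanSpace ℝ (Fin d) → ℝ) : Prop :=
  Differentiable ℝ f ∧ ∀ x y, ‖gradient f x - gradient f y‖ ≤ L * ‖x - y‖

/-- The Dobrushin coefficient `sup_{z, z'} (1/2) ‖K(z, ·) - K(z', ·)‖_TV`, where the total variation
norm of a signed measure is the total mass of its variation. -/
def dobrushinCoeff {S : Type*} [MeasurableSpace S] (K : Kernel S S) [IsMarkovKernel K] : ℝ≥0∞ :=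
  ⨆ z : S, ⨆ z' : S,
    2⁻¹ * ((K z).toSignedMeasure - (K z').toSignedMeasure).totalVariation Set.univ

/-- Powers of a Markov kernel (for the composition of kernels) are Markov kernels. -/
instance isMarkovKernel_pow {S : Type*} [MeasurableSpace S] (Q : Kernel S S) [IsMarkovKernel Q]
    (k : ℕ) : IsMarkovKernel (Q ^ k) := by
  induction k with
  | zero => rw [pow_zero]; exact inferInstanceAs (IsMarkovKernel (Kernel.id : Kernel S S))
  | succ k ih => rw [pow_succ]; exact inferInstanceAs (IsMarkovKernel ((Q ^ k) ∘ₖ Q))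

/-- `π` is the unique invariant probability measure of `Q`. -/
structure IsUniqueInvariant {S : Type*} [MeasurableSpace S] (Q : Kernel S S)
    (π : Measure S) : Prop where
  isProbabilityMeasure : IsProbabilityMeasure π
  invariant : Kernel.Invariant Q π
  unique : ∀ ν : Measure S, IsProbabilityMeasure ν → Kernel.Invariant Q ν → ν = π

/-- `Q` is uniformly geometrically ergodic with mixing time `τ`. -/
def HasMixingTime {S : Type*} [MeasurableSpace S] (Q : Kernel S S) [IsMarkovKernel Q]
    (τ : ℕ) : Prop :=
  1 ≤ τ ∧ ∀ k : ℕ, dobrushinCoeff (Q ^ k) ≤ (4⁻¹ : ℝ≥0∞) ^ (k / τ)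

/-- The σ-algebra generated by `Z 0, …, Z n`. -/
abbrev pastSigma {Ω S : Type*} [MeasurableSpace S] (Z : ℕ → Ω → S) (n : ℕ) : MeasurableSpace Ω :=
  ⨆ i ∈ Finset.range (n + 1), MeasurableSpace.comap (Z i) inferInstance

/-- Under `P`, the process `Z` is a time-homogeneous Markov chain with kernel `Q` and initial
distribution `π`. -/
structure IsMarkovChain {Ω S : Type*} [MeasurableSpace Ω] [MeasurableSpace S] (P : Measure Ω)
    (Q : Kernel S S) (π : Measure S) (Z : ℕ → Ω → S) : Prop where
  measurable : ∀ n, Measurable (Z n)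
  initial : P.map (Z 0) = π
  markov : ∀ (n : ℕ) (A : Set S), MeasurableSet A →
    P[(Z (n + 1) ⁻¹' A).indicator (fun _ => (1 : ℝ)) | pastSigma Z n]
      =ᵐ[P] fun ω => (Q (Z n ω)).real A

/-- Under `P`, the variables `J 0, J 1, …` are i.i.d. with the geometric law of parameter `1/2`
on `{1, 2, …}`, and they are independent of the process `Z`. -/
structure IsGeometricSampling {Ω S : Type*} [MeasurableSpace Ω] [MeasurableSpace S]
    (P : Measure Ω) (Z : ℕ → Ω → S) (J : ℕ → Ω → ℕ) : Prop where
  measurable : ∀ k, Measurable (J k)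
  law : ∀ k i : ℕ, 1 ≤ i → P (J k ⁻¹' {i}) = (2⁻¹ : ℝ≥0∞) ^ i
  iIndep : iIndepFun J P
  indep : IndepFun (fun ω n => Z n ω) (fun ω k => J k ω) P

/-- The objective `f(x) = 𝔼_{Z ∼ π} F(x, Z)`. -/
def objective {d : ℕ} {S : Type*} [MeasurableSpace S] (π : Measure S)
    (F : EuclideanSpace ℝ (Fin d) → S → ℝ) (x : EuclideanSpace ℝ (Fin d)) : ℝ :=
  ∫ z, F x z ∂π

/-- The stochastic gradient `∇F(x, z)`, the gradient being taken in `x`. -/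
def stochGrad {d : ℕ} {S : Type*} (F : EuclideanSpace ℝ (Fin d) → S → ℝ)
    (x : EuclideanSpace ℝ (Fin d)) (z : S) : EuclideanSpace ℝ (Fin d) :=
  gradient (fun y => F y z) x

/-- The oracle: `F(·, z)` is differentiable, `F(x, ·)` is `π`-integrable, the stochastic gradient is
unbiased under `π`, and its noise is bounded by `σ² + δ² ‖∇f(x)‖²` for every `x` and `z`. -/
structure IsGradientOracle {d : ℕ} {S : Type*} [MeasurableSpace S] (π : Measure S)
    (F : EuclideanSpace ℝ (Fin d) → S → ℝ) (σ δ : ℝ) : Prop where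
  integrable : ∀ x, Integrable (F x) π
  differentiable : ∀ z, Differentiable ℝ (fun x => F x z)
  measurable_grad : Measurable (fun p : EuclideanSpace ℝ (Fin d) × S => stochGrad F p.1 p.2)
  unbiased : ∀ x, ∫ z, stochGrad F x z ∂π = gradient (objective π F) x
  noise_bound : ∀ x z, ‖stochGrad F x z - gradient (objective π F) x‖ ^ 2
    ≤ σ ^ 2 + δ ^ 2 * ‖gradient (objective π F) x‖ ^ 2

/-- `g_j = 2^{-j} B^{-1} ∑_{i=1}^{2^j B} G(x, z_{T+i})`. -/
def batchGrad {d : ℕ} {S : Type*}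
    (G : EuclideanSpace ℝ (Fin d) → S → EuclideanSpace ℝ (Fin d)) (z : ℕ → S) (B T : ℕ)
    (x : EuclideanSpace ℝ (Fin d)) (j : ℕ) : EuclideanSpace ℝ (Fin d) :=
  ((2 : ℝ) ^ j * (B : ℝ))⁻¹ • ∑ i ∈ Finset.Icc 1 (2 ^ j * B), G x (z (T + i))

/-- `g = g_0 + 2^j (g_j - g_{j-1})` if `2^j ≤ M`, and `g = g_0` otherwise. -/
def randBatchGrad {d : ℕ} {S : Type*}
    (G : EuclideanSpace ℝ (Fin d) → S → EuclideanSpace ℝ (Fin d)) (z : ℕ → S) (B : ℕ) (M : ℝ)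
    (T : ℕ) (x : EuclideanSpace ℝ (Fin d)) (j : ℕ) : EuclideanSpace ℝ (Fin d) :=
  open Classical in
  batchGrad G z B T x 0 +
    if (2 : ℝ) ^ j ≤ M then
      (2 : ℝ) ^ j • (batchGrad G z B T x j - batchGrad G z B T x (j - 1))
    else 0

/-- The pair `(x^k, T^k)` of iterate and sample counter of the randomized-batch gradient method,
for a realization `z` of the noise sequence and a realization `j` of the batch levels. -/
def randGDState {d : ℕ} {S : Type*}
    (G : EuclideanSpace ℝ (Fin d) → S → EuclideanSpace ℝ (Fin d)) (γ : ℝ) (B : ℕ) (M : ℝ)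
    (x₀ : EuclideanSpace ℝ (Fin d)) (z : ℕ → S) (j : ℕ → ℕ) :
    ℕ → EuclideanSpace ℝ (Fin d) × ℕ
  | 0 => (x₀, 0)
  | k + 1 =>
    let s := randGDState G γ B M x₀ z j k
    (s.1 - γ • randBatchGrad G z B M s.2 s.1 (j k), s.2 + 2 ^ j k * B)

/-- The iterate `x^k`. -/
def randGDIterate {d : ℕ} {S : Type*}
    (G : EuclideanSpace ℝ (Fin d) → S → EuclideanSpace ℝ (Fin d)) (γ : ℝ) (B : ℕ) (M : ℝ)
    (x₀ : EuclideanSpace ℝ (Fin d)) (z : ℕ → S) (j : ℕ → ℕ) (k : ℕ) :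
    EuclideanSpace ℝ (Fin d) :=
  (randGDState G γ B M x₀ z j k).1

/-- The random variable `(1/N) ∑_{k=0}^{N-1} ‖∇f(x^k)‖²` for the method run with the stochastic
gradients `∇F(x, Z_i)`, the levels `J_k` and the base batch size `B = ⌈b log₂ M⌉`. -/
def avgSqGrad {d : ℕ} {Ω S : Type*} [MeasurableSpace S] (π : Measure S)
    (F : EuclideanSpace ℝ (Fin d) → S → ℝ) (Z : ℕ → Ω → S) (J : ℕ → Ω → ℕ)
    (γ : ℝ) (b : ℕ) (M : ℝ) (x₀ : EuclideanSpace ℝ (Fin d)) (N : ℕ) (ω : Ω) : ℝ :=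
  (N : ℝ)⁻¹ * ∑ k ∈ Finset.range N,
    ‖gradient (objective π F)
      (randGDIterate (stochGrad F) γ ⌈(b : ℝ) * Real.logb 2 M⌉₊ M x₀
        (fun n => Z n ω) (fun i => J i ω) k)‖ ^ 2

/-- The constant `C₁ = 16 (1 + 1 / ln² 4)`. -/
def constC₁ : ℝ := 16 * (1 + 1 / Real.log 4 ^ 2)

/-- The constant `C₂ = 256 / 3`. -/
def constC₂ : ℝ := 256 / 3

end

/-! Write the stochastic gradient as `∇f(x) + h(x, z)`, where `h(x, ·)` is centered under `π` and
bounded by `r(x) = √(σ² + δ²‖∇f(x)‖²)`. Mixing gives `‖Q^l h(x, ·)‖ ≤ 2 · 4^{-⌊l/τ⌋} r(x)`, and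
these rates sum to `O(τ)` over all lags. Once the levels are fixed, `T^k` is deterministic and `x^k`
depends only on the path up to `T^k`. So, in step `k`, a mean over `n` samples has bias `O(τ/n) r`
and mean squared error `O(τ/n) r²` (`integral_inner_batchError_le`,
`integral_norm_batchError_sq_le`). "Depends on the past" is expressed as invariance under freezing
the path with `stopPath`, so all functionals live on the one space of paths.

Averaging over the independent level `J_k` does two things. With `K = ⌊log₂ M⌋`, the weights
`2^{-i}` cancel the factors `2^i` and the expectation telescopes to that of the level-`K` batch
mean, so the bias is only `O(τ/(2^K B))` (`integral_inner_randBatchError_eq`). In the second moment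
each level costs `2^{-i} · 4^i · τ/(2^i B) = τ/B` up to constants, hence `O(Kτ/B)` in total
(`integral_norm_randBatchError_sq_le`). The choice `B = ⌈b log₂ M⌉` turns `K/B` into at most `1/b`,
and `M² ≳ 1/(γL)` turns the squared bias into `O(γL τ²/b²)`.

In the descent inequality the bias enters through Young's inequality, so both errors contribute
`O(Lγ²)(τ/b + τ²/b²) r²` (`integral_iterate_succ_le`). The `δ²‖∇f‖²` part of `r²` is absorbed by the
decrease of `f` when `γ` is small, the `σ²` part remains, and summing over `k` with `f ≥ f^*` gives
the rate (`integral_avgSqGrad_le`). -/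

noncomputable section

/-! ### Total variation, decay of centered functions, and the geometric sum of rates -/

section Mixing

variable {S : Type*} [MeasurableSpace S]
  {E : Type*} [NormedAddCommGroup E] [MeasurableSpace E]
  [BorelSpace E] [SecondCountableTopology E]

theorem integrable_of_measurable_of_norm_le {α : Type*} [MeasurableSpace α] {μ : Measure α}
    [IsFiniteMeasure μ] {g : α → E} (hg : Measurable g) (R : ℝ) (hR : ∀ a, ‖g a‖ ≤ R) :
    Integrable g μ :=
  Integrable.of_bound hg.aestronglyMeasurable R (Filter.Eventually.of_forall hR)

/-- Integrals of a function bounded by `R` against two finite measures differ by at most `R` times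
the total variation of the difference. -/
theorem norm_integral_sub_integral_le_totalVariation [NormedSpace ℝ E] {μ ν : Measure S}
    [IsFiniteMeasure μ] [IsFiniteMeasure ν] {g : S → E} (hg : Measurable g) {R : ℝ} (hR : ∀ z, ‖g z‖ ≤ R) :
    ‖∫ z, g z ∂μ - ∫ z, g z ∂ν‖
      ≤ R * ((μ.toSignedMeasure - ν.toSignedMeasure).totalVariation Set.univ).toReal := by
  set s := μ.toSignedMeasure - ν.toSignedMeasure with hs
  set p := s.toJordanDecomposition.posPart
  set q := s.toJordanDecomposition.negPart
  have hi : ∀ (m : Measure S) [IsFiniteMeasure m], Integrable g m := fun m _ =>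
    integrable_of_measurable_of_norm_le hg R hR
  -- The Jordan decomposition `μ - ν = p - q` is rearranged into an identity of positive measures,
  -- so that additivity of the Bochner integral applies to it.
  have key : μ + q = ν + p := by
    rw [← Measure.toSignedMeasure_eq_toSignedMeasure_iff, Measure.toSignedMeasure_add,
      Measure.toSignedMeasure_add]
    have h1 : s = p.toSignedMeasure - q.toSignedMeasure :=
      (SignedMeasure.toSignedMeasure_toJordanDecomposition s).symm
    replace h1 := hs.symm.trans h1
    rw [sub_eq_sub_iff_add_eq_add] at h1
    rw [h1, add_comm]
  have h2 : ∫ z, g z ∂μ + ∫ z, g z ∂q = ∫ z, g z ∂ν + ∫ z, g z ∂p := by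
    rw [← integral_add_measure (hi _) (hi _), ← integral_add_measure (hi _) (hi _), key]
  have h3 : ∫ z, g z ∂μ - ∫ z, g z ∂ν = ∫ z, g z ∂p - ∫ z, g z ∂q := by
    rw [sub_eq_sub_iff_add_eq_add, h2, add_comm]
  have h4 : ∀ (m : Measure S) [IsFiniteMeasure m], ‖∫ z, g z ∂m‖ ≤ R * (m Set.univ).toReal :=
    fun m _ => norm_integral_le_of_norm_le_const (Filter.Eventually.of_forall hR)
  rw [h3, SignedMeasure.totalVariation, Measure.add_apply,
    ENNReal.toReal_add (measure_ne_top _ _) (measure_ne_top _ _), mul_add]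
  exact (norm_sub_le _ _).trans (add_le_add (h4 _) (h4 _))

theorem HasMixingTime.totalVariation_le {Q : Kernel S S} [IsMarkovKernel Q] {τ : ℕ}
    (h : HasMixingTime Q τ) (l : ℕ) (z z' : S) :
    ((((Q ^ l) z).toSignedMeasure - ((Q ^ l) z').toSignedMeasure).totalVariation
      Set.univ).toReal ≤ 2 * (1 / 4) ^ (l / τ) := by
  have h1 := (le_iSup₂ (f := fun z z' : S => 2⁻¹ * (((Q ^ l) z).toSignedMeasure -
    ((Q ^ l) z').toSignedMeasure).totalVariation Set.univ) z z').trans (h.2 l)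
  have h2 := ENNReal.toReal_mono (by simp) h1
  simp only [ENNReal.toReal_mul, ENNReal.toReal_inv, ENNReal.toReal_pow, ENNReal.toReal_ofNat]
    at h2
  rw [one_div]
  linarith

theorem ProbabilityTheory.Kernel.Invariant.pow {Q : Kernel S S} {π : Measure S}
    (h : Kernel.Invariant Q π) (l : ℕ) : Kernel.Invariant (Q ^ l) π := by
  induction l with
  | zero =>
    rw [pow_zero]
    change Measure.bind π (Kernel.id : Kernel S S) = π
    exact Measure.bind_dirac
  | succ l ih =>
    rw [pow_succ]
    exact ih.comp h

/-- Geometric decay of `Q ^ l g` for centered bounded `g`. -/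
theorem HasMixingTime.norm_integral_pow_le [NormedSpace ℝ E] [CompleteSpace E]
    {Q : Kernel S S} [IsMarkovKernel Q] {τ : ℕ} (h : HasMixingTime Q τ) {π : Measure S} [IsProbabilityMeasure π]
    (hπ : Kernel.Invariant Q π) {g : S → E} (hg : Measurable g) {R : ℝ}
    (hR : ∀ z, ‖g z‖ ≤ R) (h0 : ∫ z, g z ∂π = 0) (l : ℕ) (w : S) :
    ‖∫ y, g y ∂((Q ^ l) w)‖ ≤ R * (2 * (1 / 4) ^ (l / τ)) := by
  have hcomp : ((Q ^ l) ∘ₖ Kernel.const S π) w = π := by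
    rw [(hπ.pow l).comp_const, Kernel.const_apply]
  have hint : Integrable g (((Q ^ l) ∘ₖ Kernel.const S π) w) := by
    rw [hcomp]
    exact integrable_of_measurable_of_norm_le hg R hR
  have h1 : ∫ w', ∫ y, g y ∂((Q ^ l) w') ∂π = 0 := by
    have h2 := Kernel.integral_comp hint
    rw [hcomp, h0, Kernel.const_apply] at h2
    exact h2.symm
  have hR0 : 0 ≤ R := (norm_nonneg _).trans (hR w)
  have hmeas : StronglyMeasurable fun w' => ∫ y, g y ∂((Q ^ l) w') :=
    hg.stronglyMeasurable.integral_kernel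
  have hb : ∀ w', ‖∫ y, g y ∂((Q ^ l) w')‖ ≤ R := fun w' => by
    simpa using norm_integral_le_of_norm_le_const (μ := (Q ^ l) w')
      (Filter.Eventually.of_forall hR)
  have hi : Integrable (fun w' => ∫ y, g y ∂((Q ^ l) w')) π :=
    Integrable.of_bound hmeas.aestronglyMeasurable R (Filter.Eventually.of_forall hb)
  -- Invariance makes the `π`-average of `Q^l g` vanish. Subtracting it leaves an average of
  -- differences between two starting points, each controlled by the Dobrushin coefficient.
  have h2 : ∫ y, g y ∂((Q ^ l) w)
      = ∫ w', (∫ y, g y ∂((Q ^ l) w) - ∫ y, g y ∂((Q ^ l) w')) ∂π := by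
    rw [integral_sub (integrable_const _) hi, h1]
    simp
  rw [h2]
  refine (norm_integral_le_of_norm_le_const (C := R * (2 * (1 / 4) ^ (l / τ)))
    (Filter.Eventually.of_forall fun w' => ?_)).trans (by simp)
  exact (norm_integral_sub_integral_le_totalVariation hg hR).trans
    (mul_le_mul_of_nonneg_left (h.totalVariation_le l w w') hR0)

/-- The exponent `⌊l/τ⌋` is constant on blocks of length `τ`, so the sum is at most `τ` times the
geometric series with ratio `1/4`. This is the source of every factor `τ` in the error bounds. -/
theorem sum_range_quarter_pow_div_le (τ : ℕ) (hτ : 1 ≤ τ) (n : ℕ) :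
    ∑ l ∈ Finset.range n, (1 / 4 : ℝ) ^ (l / τ) ≤ 4 / 3 * τ := by
  have h1 : ∀ m : ℕ, ∑ l ∈ Finset.range (τ * m), (1 / 4 : ℝ) ^ (l / τ)
      = τ * ∑ q ∈ Finset.range m, (1 / 4 : ℝ) ^ q := by
    intro m
    induction m with
    | zero => simp
    | succ m ih =>
      rw [Nat.mul_succ, Finset.sum_range_add, ih, Finset.sum_range_succ, mul_add]
      congr 1
      rw [Finset.sum_congr rfl (g := fun _ => (1 / 4 : ℝ) ^ m)]
      · simp
      · intro l hl
        rw [Nat.mul_add_div (by omega), Nat.div_eq_of_lt (Finset.mem_range.1 hl), add_zero]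
  have h2 : ∑ q ∈ Finset.range n, (1 / 4 : ℝ) ^ q ≤ 4 / 3 := by
    rw [geom_sum_eq (by norm_num)]
    have : (0 : ℝ) ≤ (1 / 4) ^ n := by positivity
    rw [div_le_iff_of_neg (by norm_num)]
    linarith
  calc ∑ l ∈ Finset.range n, (1 / 4 : ℝ) ^ (l / τ)
      ≤ ∑ l ∈ Finset.range (τ * n), (1 / 4 : ℝ) ^ (l / τ) := by
        refine Finset.sum_le_sum_of_subset_of_nonneg ?_ fun _ _ _ => by positivity
        exact Finset.range_subset_range.2 (Nat.le_mul_of_pos_left n hτ)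
    _ = τ * ∑ q ∈ Finset.range n, (1 / 4 : ℝ) ^ q := h1 n
    _ ≤ τ * (4 / 3) := by gcongr
    _ = 4 / 3 * τ := mul_comm _ _

end Mixing

/-! ### Path laws, frozen paths and the Markov property at arbitrary lags -/

section Paths

variable {S : Type*} [MeasurableSpace S]

/-- The path `z` frozen after time `t`. -/
def stopPath {S : Type*} (t : ℕ) (z : ℕ → S) : ℕ → S := fun n => z (min n t)

theorem measurable_stopPath (t : ℕ) : Measurable (stopPath t : (ℕ → S) → ℕ → S) :=
  measurable_pi_iff.2 fun _ => measurable_pi_apply _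

theorem stopPath_stopPath_of_le {S : Type*} {t s : ℕ} (h : t ≤ s) (z : ℕ → S) :
    stopPath t (stopPath s z) = stopPath t z := by
  funext n
  simp only [stopPath]
  congr 1
  omega

theorem stopPath_apply_of_le {S : Type*} {t n : ℕ} (h : n ≤ t) (z : ℕ → S) :
    stopPath t z n = z n := by
  simp [stopPath, h]

/-- `μ` is the path law of a time-homogeneous Markov chain with kernel `Q`. -/
def IsMarkovPathLaw (Q : Kernel S S) (μ : Measure (ℕ → S)) : Prop :=
  ∀ t, μ.map (fun z => (stopPath t z, z (t + 1)))
    = μ.map (stopPath t) ⊗ₘ Q.comap (fun z : ℕ → S => z t) (measurable_pi_apply t)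

theorem IsMarkovPathLaw.lintegral_step {Q : Kernel S S} [IsMarkovKernel Q]
    {μ : Measure (ℕ → S)} [IsProbabilityMeasure μ] (hμ : IsMarkovPathLaw Q μ)
    {ψ : (ℕ → S) × S → ℝ≥0∞} (hψ : Measurable ψ) (t : ℕ) :
    ∫⁻ z, ψ (stopPath t z, z (t + 1)) ∂μ = ∫⁻ z, ∫⁻ y, ψ (stopPath t z, y) ∂(Q (z t)) ∂μ := by
  have hm : Measurable fun z : ℕ → S => (stopPath t z, z (t + 1)) :=
    (measurable_stopPath t).prodMk (measurable_pi_apply _)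
  have := Measure.isProbabilityMeasure_map (μ := μ) (measurable_stopPath t).aemeasurable
  rw [← lintegral_map hψ hm, hμ t, Measure.lintegral_compProd hψ, lintegral_map _
    (measurable_stopPath t)]
  · simp only [Kernel.comap_apply, stopPath_apply_of_le le_rfl]
  · exact Measurable.lintegral_kernel_prod_right' hψ

/-- Chapman–Kolmogorov by induction on the lag: the last transition is integrated out at time `t +
l`, which replaces `ψ` by its average under one step of `Q`. The induction must therefore range over
all `ψ`. -/
theorem IsMarkovPathLaw.lintegral_pow {Q : Kernel S S} [IsMarkovKernel Q]
    {μ : Measure (ℕ → S)} [IsProbabilityMeasure μ] (hμ : IsMarkovPathLaw Q μ)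
    (t l : ℕ) {ψ : (ℕ → S) × S → ℝ≥0∞} (hψ : Measurable ψ) :
    ∫⁻ z, ψ (stopPath t z, z (t + l)) ∂μ
      = ∫⁻ z, ∫⁻ y, ψ (stopPath t z, y) ∂((Q ^ l) (z t)) ∂μ := by
  induction l generalizing ψ with
  | zero =>
    have : ∀ w : S, (Q ^ 0) w = Measure.dirac w := fun w => by
      rw [pow_zero]; exact Kernel.id_apply w
    refine lintegral_congr fun z => ?_
    have hψz : Measurable fun y => ψ (stopPath t z, y) := hψ.comp measurable_prodMk_left
    rw [this, lintegral_dirac' _ hψz, add_zero]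
  | succ l ih =>
    have h1 := hμ.lintegral_step (ψ := fun p => ψ (stopPath t p.1, p.2))
      (hψ.comp (((measurable_stopPath t).comp measurable_fst).prodMk measurable_snd)) (t + l)
    simp only [stopPath_stopPath_of_le (Nat.le_add_right t l)] at h1
    have hψ' : Measurable fun p : (ℕ → S) × S => ∫⁻ y, ψ (p.1, y) ∂(Q p.2) := by
      have h2 := Measurable.lintegral_kernel_prod_right' (κ := Q.comap
        (Prod.snd : (ℕ → S) × S → S) measurable_snd)
        (f := fun q : ((ℕ → S) × S) × S => ψ (q.1.1, q.2))
        (hψ.comp ((measurable_fst.comp measurable_fst).prodMk measurable_snd))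
      simpa only [Kernel.comap_apply] using h2
    rw [← add_assoc, h1, ih hψ']
    refine lintegral_congr fun z => ?_
    rw [pow_succ']
    exact (Kernel.lintegral_comp _ _ _ (hψ.comp measurable_prodMk_left)).symm

theorem IsMarkovPathLaw.map_eq_compProd_pow {Q : Kernel S S} [IsMarkovKernel Q]
    {μ : Measure (ℕ → S)} [IsProbabilityMeasure μ] (hμ : IsMarkovPathLaw Q μ) (t l : ℕ) :
    μ.map (fun z => (stopPath t z, z (t + l)))
      = μ.map (stopPath t) ⊗ₘ (Q ^ l).comap (fun z : ℕ → S => z t) (measurable_pi_apply t) := by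
  have hm : Measurable fun z : ℕ → S => (stopPath t z, z (t + l)) :=
    (measurable_stopPath t).prodMk (measurable_pi_apply _)
  have := Measure.isProbabilityMeasure_map (μ := μ) (measurable_stopPath t).aemeasurable
  refine Measure.ext_of_lintegral _ fun ψ hψ => ?_
  rw [lintegral_map hψ hm, hμ.lintegral_pow t l hψ, Measure.lintegral_compProd hψ, lintegral_map _
    (measurable_stopPath t)]
  · simp only [Kernel.comap_apply, stopPath_apply_of_le le_rfl]
  · exact Measurable.lintegral_kernel_prod_right' hψ

theorem IsMarkovPathLaw.integral_pow {Q : Kernel S S} [IsMarkovKernel Q]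
    {μ : Measure (ℕ → S)} [IsProbabilityMeasure μ] (hμ : IsMarkovPathLaw Q μ)
    (t l : ℕ) {ψ : (ℕ → S) × S → ℝ} (hψ : Measurable ψ) {R : ℝ} (hR : ∀ p, ‖ψ p‖ ≤ R) :
    ∫ z, ψ (stopPath t z, z (t + l)) ∂μ
      = ∫ z, ∫ y, ψ (stopPath t z, y) ∂((Q ^ l) (z t)) ∂μ := by
  have hm : Measurable fun z : ℕ → S => (stopPath t z, z (t + l)) :=
    (measurable_stopPath t).prodMk (measurable_pi_apply _)
  have := Measure.isProbabilityMeasure_map (μ := μ) (measurable_stopPath t).aemeasurable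
  rw [← integral_map hm.aemeasurable hψ.aestronglyMeasurable, hμ.map_eq_compProd_pow t l,
    Measure.integral_compProd (integrable_of_measurable_of_norm_le hψ R hR), integral_map
    (measurable_stopPath t).aemeasurable]
  · simp only [Kernel.comap_apply, stopPath_apply_of_le le_rfl]
  · exact (hψ.stronglyMeasurable.integral_kernel_prod_right').aestronglyMeasurable

/-- Rectangles `A ×ˢ B` determine the joint law. Since the frozen path is measurable with respect to
`pastSigma Z t`, the event that it lies in `A` may be used to integrate the conditional probability
of `Z (t + 1) ∈ B`. -/
theorem IsMarkovChain.isMarkovPathLaw {Ω : Type*} [MeasurableSpace Ω] {P : Measure Ω}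
    [IsProbabilityMeasure P] {Q : Kernel S S} [IsMarkovKernel Q] {π : Measure S}
    {Z : ℕ → Ω → S} (h : IsMarkovChain P Q π Z) :
    IsMarkovPathLaw Q (P.map fun ω n => Z n ω) := by
  intro t
  have hZ : Measurable fun ω n => Z n ω := measurable_pi_iff.2 h.measurable
  have hm : Measurable fun z : ℕ → S => (stopPath t z, z (t + 1)) :=
    (measurable_stopPath t).prodMk (measurable_pi_apply _)
  have := Measure.isProbabilityMeasure_map (μ := P) hZ.aemeasurable
  have := Measure.isProbabilityMeasure_map (μ := P.map fun ω n => Z n ω)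
    (measurable_stopPath (S := S) t).aemeasurable
  have := Measure.isProbabilityMeasure_map (μ := P.map fun ω n => Z n ω) hm.aemeasurable
  have hle : pastSigma Z t ≤ ‹MeasurableSpace Ω› :=
    iSup₂_le fun i _ => (h.measurable i).comap_le
  have hpast : Measurable[pastSigma Z t] fun ω => stopPath t fun n => Z n ω := by
    refine @measurable_pi_lambda _ _ _ (pastSigma Z t) _ _ fun n => ?_
    refine Measurable.mono (comap_measurable (Z (min n t))) ?_ le_rfl
    exact le_iSup₂ (f := fun i (_ : i ∈ Finset.range (t + 1)) =>
      MeasurableSpace.comap (Z i) inferInstance) (min n t) (Finset.mem_range.2 (by omega))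
  refine Measure.ext_prod fun {A B} hA hB => ?_
  rw [Measure.map_apply hm (hA.prod hB), Measure.map_apply hZ (hm (hA.prod hB)),
    Measure.compProd_apply_prod hA hB, Measure.map_map (measurable_stopPath t) hZ,
    setLIntegral_map hA ((Kernel.measurable_coe _ hB))
      ((measurable_stopPath t).comp hZ)]
  simp only [Kernel.comap_apply, Function.comp_apply, stopPath_apply_of_le le_rfl]
  set A' := (fun ω => stopPath t fun n => Z n ω) ⁻¹' A with hA'
  have hA'm : MeasurableSet[pastSigma Z t] A' := hpast hA
  have hBm : MeasurableSet (Z (t + 1) ⁻¹' B) := h.measurable _ hB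
  have h1 := setIntegral_condExp (μ := P) hle
    (f := (Z (t + 1) ⁻¹' B).indicator fun _ => (1 : ℝ))
    ((integrable_const 1).indicator hBm) hA'm
  have h2 : ∫ ω in A', (Q (Z t ω)).real B ∂P
      = ∫ ω in A', (Z (t + 1) ⁻¹' B).indicator (fun _ => (1 : ℝ)) ω ∂P := by
    rw [← h1]
    exact integral_congr_ae (ae_restrict_of_ae (h.markov t B hB).symm)
  rw [integral_indicator_const _ hBm, smul_eq_mul, mul_one, measureReal_restrict_apply hBm] at h2
  have h3 : ∫ ω in A', (Q (Z t ω)).real B ∂P = (∫⁻ ω in A', Q (Z t ω) B ∂P).toReal :=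
    integral_toReal (((Kernel.measurable_coe Q hB).comp (h.measurable t)).aemeasurable)
      (Filter.Eventually.of_forall fun ω => measure_lt_top _ _)
  have h4 : ∫⁻ ω in A', Q (Z t ω) B ∂P ≠ ∞ := by
    refine ne_top_of_le_ne_top (b := ∫⁻ ω in A', 1 ∂P) (by simp) ?_
    exact lintegral_mono fun ω => prob_le_one
  have h5 : (fun ω n => Z n ω) ⁻¹' ((fun z => (stopPath t z, z (t + 1))) ⁻¹' A ×ˢ B)
      = Z (t + 1) ⁻¹' B ∩ A' := by
    ext ω; simp [hA', and_comm]
  rw [h3] at h2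
  change P _ = ∫⁻ ω in A', Q (Z t ω) B ∂P
  rw [h5, ← ENNReal.toReal_eq_toReal_iff' (measure_ne_top _ _) h4, h2]
  rfl

end Paths

/-! ### The quadratic upper bound for smooth functions -/

section Descent

theorem LSmooth.continuous_gradient {d : ℕ} {L : ℝ} {f : EuclideanSpace ℝ (Fin d) → ℝ}
    (h : LSmooth L f) : Continuous (gradient f) := by
  refine (LipschitzWith.of_dist_le_mul (K := L.toNNReal) fun x y => ?_).continuous
  rw [dist_eq_norm, dist_eq_norm]
  exact (h.2 x y).trans (mul_le_mul_of_nonneg_right (Real.le_coe_toNNReal L) (norm_nonneg _))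

/-- Along the segment, `f (x + s v)` minus its linear part and minus `(L/2)‖v‖² s²` has nonpositive
derivative, by Cauchy–Schwarz and the Lipschitz gradient. Comparing `s = 0` with `s = 1` gives the
bound, without convexity. -/
theorem LSmooth.le_add_inner_add_sq {d : ℕ} {L : ℝ} {f : EuclideanSpace ℝ (Fin d) → ℝ}
    (h : LSmooth L f) (x v : EuclideanSpace ℝ (Fin d)) :
    f (x + v) ≤ f x + inner ℝ (gradient f x) v + L / 2 * ‖v‖ ^ 2 := by
  have hd : ∀ s : ℝ, HasDerivAt (fun s : ℝ => f (x + s • v) - s * inner ℝ (gradient f x) v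
      - L / 2 * ‖v‖ ^ 2 * s ^ 2)
      (inner ℝ (gradient f (x + s • v)) v - inner ℝ (gradient f x) v - L * ‖v‖ ^ 2 * s) s := by
    intro s
    have h1 : HasDerivAt (fun s : ℝ => x + s • v) v s := by
      simpa using ((hasDerivAt_id s).smul_const v).const_add x
    have h2 := ((h.1 (x + s • v)).hasGradientAt.hasFDerivAt).comp_hasDerivAt s h1
    have h3 := (h2.sub ((hasDerivAt_id s).mul_const (inner ℝ (gradient f x) v))).sub
      ((hasDerivAt_pow 2 s).const_mul (L / 2 * ‖v‖ ^ 2))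
    refine h3.congr_deriv ?_
    simp
    ring
  have hanti : AntitoneOn (fun s : ℝ => f (x + s • v) - s * inner ℝ (gradient f x) v
      - L / 2 * ‖v‖ ^ 2 * s ^ 2) (Set.Icc 0 1) := by
    refine antitoneOn_of_deriv_nonpos (convex_Icc 0 1)
      (fun s _ => (hd s).continuousAt.continuousWithinAt)
      (fun s _ => (hd s).differentiableAt.differentiableWithinAt) fun s hs => ?_
    rw [interior_Icc] at hs
    rw [(hd s).deriv, ← inner_sub_left]
    have h1 := real_inner_le_norm (gradient f (x + s • v) - gradient f x) v
    have h2 := h.2 (x + s • v) x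
    rw [add_sub_cancel_left, norm_smul, Real.norm_of_nonneg hs.1.le] at h2
    have h3 := mul_le_mul_of_nonneg_right h2 (norm_nonneg v)
    nlinarith
  have := hanti (Set.left_mem_Icc.2 zero_le_one) (Set.right_mem_Icc.2 zero_le_one) zero_le_one
  simp only [one_smul, one_mul, zero_smul, zero_mul, add_zero, one_pow, mul_one, sub_zero,
    ne_eq, OfNat.ofNat_ne_zero, not_false_eq_true, zero_pow, mul_zero] at this
  linarith

end Descent

/-! ### Bias and second moment of sums of Markovian noise -/

section PathEstimates

theorem sum_Icc_quarter_pow_dist_le (τ : ℕ) (hτ : 1 ≤ τ) (n i : ℕ) (hi : i ∈ Finset.Icc 1 n) :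
    ∑ j ∈ Finset.Icc 1 n, (1 / 4 : ℝ) ^ (Nat.dist i j / τ) ≤ 8 / 3 * τ := by
  obtain ⟨hi1, hin⟩ := Finset.mem_Icc.1 hi
  have h0 : Finset.Icc 1 n = Finset.Ico 1 (n + 1) := rfl
  rw [h0, ← Finset.sum_Ico_consecutive _ hi1 (show i ≤ n + 1 by omega)]
  have h1 : ∑ j ∈ Finset.Ico i (n + 1), (1 / 4 : ℝ) ^ (Nat.dist i j / τ) ≤ 4 / 3 * τ := by
    rw [Finset.sum_Ico_eq_sum_range]
    refine le_trans (le_of_eq (Finset.sum_congr rfl fun l _ => ?_))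
      (sum_range_quarter_pow_div_le τ hτ (n + 1 - i))
    simp [Nat.dist]
  have h2 : ∑ j ∈ Finset.Ico 1 i, (1 / 4 : ℝ) ^ (Nat.dist i j / τ) ≤ 4 / 3 * τ := by
    calc ∑ j ∈ Finset.Ico 1 i, (1 / 4 : ℝ) ^ (Nat.dist i j / τ)
        ≤ ∑ j ∈ Finset.range i, (1 / 4 : ℝ) ^ (Nat.dist i j / τ) := by
          refine Finset.sum_le_sum_of_subset_of_nonneg (fun j hj => ?_) fun _ _ _ => by positivity
          exact Finset.mem_range.2 (Finset.mem_Ico.1 hj).2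
      -- Shortening the distance `i - j` by one only enlarges the power, and makes the sum an exact
      -- reflection of the one-sided sum.
      _ ≤ ∑ j ∈ Finset.range i, (1 / 4 : ℝ) ^ ((i - 1 - j) / τ) := by
          refine Finset.sum_le_sum fun j hj => ?_
          have := Finset.mem_range.1 hj
          refine pow_le_pow_of_le_one (by norm_num) (by norm_num) (Nat.div_le_div_right ?_)
          simp only [Nat.dist]
          omega
      _ = ∑ j ∈ Finset.range i, (1 / 4 : ℝ) ^ (j / τ) :=
          Finset.sum_range_reflect (fun j => (1 / 4 : ℝ) ^ (j / τ)) i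
      _ ≤ 4 / 3 * τ := sum_range_quarter_pow_div_le τ hτ i
  linarith

theorem sum_Icc_quarter_pow_div_le (τ : ℕ) (hτ : 1 ≤ τ) (n : ℕ) :
    ∑ i ∈ Finset.Icc 1 n, (1 / 4 : ℝ) ^ (i / τ) ≤ 4 / 3 * τ := by
  refine le_trans (Finset.sum_le_sum_of_subset_of_nonneg (t := Finset.range (n + 1))
    (fun j hj => ?_) fun _ _ _ => by positivity) (sum_range_quarter_pow_div_le τ hτ (n + 1))
  have := Finset.mem_Icc.1 hj
  exact Finset.mem_range.2 (by omega)

variable {S : Type*} [MeasurableSpace S]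
  {E : Type*} [NormedAddCommGroup E] [InnerProductSpace ℝ E] [MeasurableSpace E]
  [BorelSpace E] [SecondCountableTopology E]

/-- `h x` is a `π`-centered field bounded by `r x`. -/
structure IsCenteredNoise (π : Measure S) (h : E → S → E) (r : E → ℝ) : Prop where
  measurable : Measurable fun p : E × S => h p.1 p.2
  measurable_bound : Measurable r
  norm_le : ∀ x z, ‖h x z‖ ≤ r x
  integral_eq_zero : ∀ x, ∫ z, h x z ∂π = 0

variable {π : Measure S} {h : E → S → E} {r : E → ℝ} {μ : Measure (ℕ → S)}

/-- Correlation of the past up to time `t` with the noise at time `t + l`. -/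
theorem IsMarkovPathLaw.integral_inner_noise_le [CompleteSpace E] {Q : Kernel S S}
    [IsMarkovKernel Q] [IsProbabilityMeasure μ] (hμ : IsMarkovPathLaw Q μ) {τ : ℕ}
    (hQ : HasMixingTime Q τ) [IsProbabilityMeasure π] (hπ : Kernel.Invariant Q π)
    (hh : IsCenteredNoise π h r) {t : ℕ} (l : ℕ) {ψ X : (ℕ → S) → E} (hψ : Measurable ψ)
    (hX : Measurable X) {C R : ℝ} (hC : ∀ z, ‖ψ z‖ ≤ C) (hR : ∀ z, r (X z) ≤ R)
    (hψt : ∀ z, ψ (stopPath t z) = ψ z) (hXt : ∀ z, X (stopPath t z) = X z) :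
    ∫ z, inner ℝ (ψ z) (h (X z) (z (t + l))) ∂μ
      ≤ (2 * (1 / 4) ^ (l / τ)) * ∫ z, ‖ψ z‖ * r (X z) ∂μ := by
  have hr0 : ∀ z, 0 ≤ r (X z) := fun z => (norm_nonneg _).trans (hh.norm_le (X z) (z 0))
  have hC0 : ∀ z : ℕ → S, 0 ≤ C := fun z => (norm_nonneg _).trans (hC z)
  have hm : Measurable fun p : (ℕ → S) × S => inner ℝ (ψ p.1) (h (X p.1) p.2) :=
    (hψ.comp measurable_fst).inner
      (hh.measurable.comp ((hX.comp measurable_fst).prodMk measurable_snd))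
  have hb : ∀ p : (ℕ → S) × S, ‖inner ℝ (ψ p.1) (h (X p.1) p.2)‖ ≤ C * R := fun p =>
    (norm_inner_le_norm _ _).trans (mul_le_mul (hC _) ((hh.norm_le _ _).trans (hR _))
      (norm_nonneg _) (hC0 p.1))
  have h1 := hμ.integral_pow t l hm hb
  simp only [hψt, hXt] at h1
  have hmh : ∀ x, Measurable (h x) := fun x => hh.measurable.comp measurable_prodMk_left
  rw [h1, ← integral_const_mul]
  have hint : Integrable (fun z => (2 * (1 / 4) ^ (l / τ)) * (‖ψ z‖ * r (X z))) μ := by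
    refine Integrable.const_mul (integrable_of_measurable_of_norm_le
      (hψ.norm.mul (hh.measurable_bound.comp hX)) (C * R) fun z => ?_) _
    change ‖‖ψ z‖ * r (X z)‖ ≤ C * R
    rw [Real.norm_of_nonneg (mul_nonneg (norm_nonneg _) (hr0 z))]
    exact mul_le_mul (hC z) (hR z) (hr0 z) (hC0 z)
  refine (Real.le_norm_self _).trans (norm_integral_le_of_norm_le hint
    (Filter.Eventually.of_forall fun z => ?_))
  -- With the past frozen, `ψ` and `X` are constants, so the inner integral is `ψ` against `Q^l h(X,
  -- ·)`, which decays by mixing.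
  rw [integral_inner (integrable_of_measurable_of_norm_le (hmh _) _ (hh.norm_le _))]
  refine (norm_inner_le_norm _ _).trans ?_
  have h2 := hQ.norm_integral_pow_le hπ (hmh (X z)) (hh.norm_le _) (hh.integral_eq_zero _) l (z t)
  have h3 := mul_le_mul_of_nonneg_left h2 (norm_nonneg (ψ z))
  linarith

theorem IsMarkovPathLaw.integral_inner_sum_noise_le [CompleteSpace E] {Q : Kernel S S}
    [IsMarkovKernel Q] [IsProbabilityMeasure μ] (hμ : IsMarkovPathLaw Q μ) {τ : ℕ}
    (hQ : HasMixingTime Q τ) [IsProbabilityMeasure π] (hπ : Kernel.Invariant Q π)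
    (hh : IsCenteredNoise π h r) {t : ℕ} (n : ℕ) {ψ X : (ℕ → S) → E} (hψ : Measurable ψ)
    (hX : Measurable X) {C R : ℝ} (hC : ∀ z, ‖ψ z‖ ≤ C) (hR : ∀ z, r (X z) ≤ R)
    (hψt : ∀ z, ψ (stopPath t z) = ψ z) (hXt : ∀ z, X (stopPath t z) = X z) :
    ∫ z, inner ℝ (ψ z) (∑ i ∈ Finset.Icc 1 n, h (X z) (z (t + i))) ∂μ
      ≤ 8 / 3 * τ * ∫ z, ‖ψ z‖ * r (X z) ∂μ := by
  have hr0 : ∀ z, 0 ≤ r (X z) := fun z => (norm_nonneg _).trans (hh.norm_le (X z) (z 0))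
  have hi : ∀ i, Integrable (fun z => inner ℝ (ψ z) (h (X z) (z (t + i)))) μ := fun i => by
    refine integrable_of_measurable_of_norm_le (hψ.inner
      (hh.measurable.comp (hX.prodMk (measurable_pi_apply _)))) (C * R) fun z => ?_
    exact (norm_inner_le_norm _ _).trans (mul_le_mul (hC _) ((hh.norm_le _ _).trans (hR _))
      (norm_nonneg _) ((norm_nonneg _).trans (hC z)))
  simp only [inner_sum]
  rw [integral_finsetSum _ fun i _ => hi i]
  have hI : 0 ≤ ∫ z, ‖ψ z‖ * r (X z) ∂μ :=
    integral_nonneg fun z => mul_nonneg (norm_nonneg _) (hr0 z)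
  calc _ ≤ ∑ i ∈ Finset.Icc 1 n, (2 * (1 / 4) ^ (i / τ)) * ∫ z, ‖ψ z‖ * r (X z) ∂μ :=
        Finset.sum_le_sum fun i _ =>
          hμ.integral_inner_noise_le hQ hπ hh i hψ hX hC hR hψt hXt
    _ = 2 * (∑ i ∈ Finset.Icc 1 n, (1 / 4 : ℝ) ^ (i / τ)) * ∫ z, ‖ψ z‖ * r (X z) ∂μ := by
        rw [← Finset.sum_mul, ← Finset.mul_sum]
    _ ≤ 2 * (4 / 3 * τ) * ∫ z, ‖ψ z‖ * r (X z) ∂μ := by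
        gcongr
        exact sum_Icc_quarter_pow_div_le τ hQ.1 n
    _ = _ := by ring

/-- The earlier noise term belongs to the past at time `t + i`, so the correlation bound applies
with that term as `ψ` and with lag `j - i`. -/
theorem IsMarkovPathLaw.integral_inner_noise_noise_le [CompleteSpace E] {Q : Kernel S S}
    [IsMarkovKernel Q] [IsProbabilityMeasure μ] (hμ : IsMarkovPathLaw Q μ) {τ : ℕ}
    (hQ : HasMixingTime Q τ) [IsProbabilityMeasure π] (hπ : Kernel.Invariant Q π)
    (hh : IsCenteredNoise π h r) {t : ℕ} {i j : ℕ} (hij : i ≤ j) {X : (ℕ → S) → E}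
    (hX : Measurable X) {R : ℝ} (hR : ∀ z, r (X z) ≤ R) (hXt : ∀ z, X (stopPath t z) = X z) :
    ∫ z, inner ℝ (h (X z) (z (t + i))) (h (X z) (z (t + j))) ∂μ
      ≤ (2 * (1 / 4) ^ (Nat.dist i j / τ)) * ∫ z, r (X z) ^ 2 ∂μ := by
  have hr0 : ∀ z, 0 ≤ r (X z) := fun z => (norm_nonneg _).trans (hh.norm_le (X z) (z 0))
  have hXs : ∀ z, X (stopPath (t + i) z) = X z := fun z => by
    rw [← hXt, stopPath_stopPath_of_le (Nat.le_add_right t i), hXt]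
  have h1 := hμ.integral_inner_noise_le hQ hπ hh (t := t + i) (j - i)
    (ψ := fun z => h (X z) (z (t + i)))
    (hh.measurable.comp (hX.prodMk (measurable_pi_apply _))) hX (C := R)
    (fun z => (hh.norm_le _ _).trans (hR z)) hR
    (fun z => by rw [hXs, stopPath_apply_of_le le_rfl]) hXs
  rw [show t + i + (j - i) = t + j by omega,
    show j - i = Nat.dist i j by simp only [Nat.dist]; omega] at h1
  refine h1.trans (mul_le_mul_of_nonneg_left ?_ (by positivity))
  refine integral_mono_of_nonneg
    (Filter.Eventually.of_forall fun z => mul_nonneg (norm_nonneg _) (hr0 z)) ?_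
    (Filter.Eventually.of_forall fun z => ?_)
  · refine integrable_of_measurable_of_norm_le ((hh.measurable_bound.comp hX).pow_const 2)
      (R ^ 2) fun z => ?_
    change ‖r (X z) ^ 2‖ ≤ R ^ 2
    rw [Real.norm_of_nonneg (sq_nonneg _)]
    exact pow_le_pow_left₀ (hr0 z) (hR z) 2
  · change ‖h (X z) (z (t + i))‖ * r (X z) ≤ r (X z) ^ 2
    rw [sq]
    exact mul_le_mul_of_nonneg_right (hh.norm_le _ _) (hr0 z)

/-- Expanding the square gives `n²` correlations, but each row sums to `O(τ)` because they decay
geometrically in `|i - j|`. Hence the growth is `τ n` rather than `n²`. -/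
theorem IsMarkovPathLaw.integral_norm_sum_noise_sq_le [CompleteSpace E] {Q : Kernel S S}
    [IsMarkovKernel Q] [IsProbabilityMeasure μ] (hμ : IsMarkovPathLaw Q μ) {τ : ℕ}
    (hQ : HasMixingTime Q τ) [IsProbabilityMeasure π] (hπ : Kernel.Invariant Q π)
    (hh : IsCenteredNoise π h r) {t : ℕ} (n : ℕ) {X : (ℕ → S) → E}
    (hX : Measurable X) {R : ℝ} (hR : ∀ z, r (X z) ≤ R) (hXt : ∀ z, X (stopPath t z) = X z) :
    ∫ z, ‖∑ i ∈ Finset.Icc 1 n, h (X z) (z (t + i))‖ ^ 2 ∂μ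
      ≤ 16 / 3 * τ * n * ∫ z, r (X z) ^ 2 ∂μ := by
  have hmh : ∀ i, Measurable fun z : ℕ → S => h (X z) (z (t + i)) := fun i =>
    hh.measurable.comp (hX.prodMk (measurable_pi_apply _))
  have hi : ∀ i j, Integrable
      (fun z => inner ℝ (h (X z) (z (t + i))) (h (X z) (z (t + j)))) μ := fun i j => by
    refine integrable_of_measurable_of_norm_le ((hmh i).inner (hmh j)) (R * R) fun z => ?_
    have hb := fun i => (hh.norm_le (X z) (z (t + i))).trans (hR z)
    exact (norm_inner_le_norm _ _).trans (mul_le_mul (hb _) (hb _)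
      (norm_nonneg _) ((norm_nonneg _).trans (hb i)))
  have hij : ∀ i j, ∫ z, inner ℝ (h (X z) (z (t + i))) (h (X z) (z (t + j))) ∂μ
      ≤ (2 * (1 / 4) ^ (Nat.dist i j / τ)) * ∫ z, r (X z) ^ 2 ∂μ := fun i j => by
    rcases le_total i j with hle | hle
    · exact hμ.integral_inner_noise_noise_le hQ hπ hh hle hX hR hXt
    · rw [Nat.dist_comm]
      refine (integral_congr_ae (Filter.Eventually.of_forall fun z =>
        real_inner_comm _ _)).trans_le ?_
      exact hμ.integral_inner_noise_noise_le hQ hπ hh hle hX hR hXt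
  have hI : 0 ≤ ∫ z, r (X z) ^ 2 ∂μ := integral_nonneg fun z => sq_nonneg _
  simp only [← real_inner_self_eq_norm_sq, sum_inner, inner_sum]
  rw [integral_finsetSum _ fun i _ => integrable_finsetSum _ fun j _ => hi _ _]
  calc _ ≤ ∑ i ∈ Finset.Icc 1 n, (16 / 3 * τ) * ∫ z, r (X z) ^ 2 ∂μ := by
        refine Finset.sum_le_sum fun i hin => ?_
        rw [integral_finsetSum _ fun j _ => hi _ _]
        calc _ ≤ ∑ j ∈ Finset.Icc 1 n, (2 * (1 / 4) ^ (Nat.dist i j / τ)) *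
              ∫ z, r (X z) ^ 2 ∂μ := Finset.sum_le_sum fun j _ => ?_
          _ = 2 * (∑ j ∈ Finset.Icc 1 n, (1 / 4 : ℝ) ^ (Nat.dist i j / τ)) *
              ∫ z, r (X z) ^ 2 ∂μ := by rw [← Finset.sum_mul, ← Finset.mul_sum]
          _ ≤ 2 * (8 / 3 * τ) * ∫ z, r (X z) ^ 2 ∂μ := by
              gcongr
              exact sum_Icc_quarter_pow_dist_le τ hQ.1 n i hin
          _ = _ := by ring
        rw [Nat.dist_comm]
        exact hij j i
    _ = _ := by
        rw [Finset.sum_const, Nat.card_Icc, nsmul_eq_mul, Nat.add_sub_cancel]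
        ring

end PathEstimates

/-! ### Adaptedness, boundedness and measurability of the iterates -/

section Iterates

variable {d : ℕ} {S : Type*} {G : EuclideanSpace ℝ (Fin d) → S → EuclideanSpace ℝ (Fin d)}
  {γ : ℝ} {B : ℕ} {M : ℝ} {x₀ : EuclideanSpace ℝ (Fin d)}

/-- The sample counter `T^k`, as a function of the levels. -/
def sampleCount (B : ℕ) (j : ℕ → ℕ) (k : ℕ) : ℕ := ∑ i ∈ Finset.range k, 2 ^ j i * B

theorem randGDState_snd (z : ℕ → S) (j : ℕ → ℕ) (k : ℕ) :
    (randGDState G γ B M x₀ z j k).2 = sampleCount B j k := by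
  induction k with
  | zero => simp [randGDState, sampleCount]
  | succ k ih =>
    rw [sampleCount, Finset.sum_range_succ, ← sampleCount, ← ih]
    rfl

theorem randGDIterate_succ (z : ℕ → S) (j : ℕ → ℕ) (k : ℕ) :
    randGDIterate G γ B M x₀ z j (k + 1) = randGDIterate G γ B M x₀ z j k
      - γ • randBatchGrad G z B M (sampleCount B j k) (randGDIterate G γ B M x₀ z j k) (j k) := by
  rw [← randGDState_snd (G := G) (γ := γ) (M := M) (x₀ := x₀) z]
  rfl

theorem batchGrad_congr {z z' : ℕ → S} {T i : ℕ} (x : EuclideanSpace ℝ (Fin d))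
    (h : ∀ n ≤ T + 2 ^ i * B, z n = z' n) : batchGrad G z B T x i = batchGrad G z' B T x i := by
  unfold batchGrad
  congr 1
  refine Finset.sum_congr rfl fun n hn => ?_
  rw [h _ (Nat.add_le_add_left (Finset.mem_Icc.1 hn).2 _)]

theorem randBatchGrad_congr {z z' : ℕ → S} {T i : ℕ} (x : EuclideanSpace ℝ (Fin d))
    (h : ∀ n ≤ T + 2 ^ i * B, z n = z' n) :
    randBatchGrad G z B M T x i = randBatchGrad G z' B M T x i := by
  have h' : ∀ l ≤ i, batchGrad G z B T x l = batchGrad G z' B T x l := fun l hl =>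
    batchGrad_congr x fun n hn => h n (hn.trans (by gcongr; norm_num))
  unfold randBatchGrad
  rw [h' 0 (Nat.zero_le _), h' i le_rfl, h' (i - 1) (Nat.sub_le _ _)]

theorem randGDIterate_congr {z z' : ℕ → S} {j j' : ℕ → ℕ} (k : ℕ) (hj : ∀ i < k, j i = j' i)
    (hz : ∀ n ≤ sampleCount B j k, z n = z' n) :
    randGDIterate G γ B M x₀ z j k = randGDIterate G γ B M x₀ z' j' k := by
  induction k with
  | zero => rfl
  | succ k ih =>
    have hc : sampleCount B j (k + 1) = sampleCount B j k + 2 ^ j k * B :=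
      Finset.sum_range_succ _ _
    have hT : sampleCount B j k = sampleCount B j' k := Finset.sum_congr rfl fun i hi => by
      rw [hj i ((Finset.mem_range.1 hi).trans (Nat.lt_succ_self k))]
    rw [randGDIterate_succ, randGDIterate_succ, ih (fun i hi => hj i (by omega))
      (fun n hn => hz n (by omega)), ← hj k (Nat.lt_succ_self k), ← hT,
      randBatchGrad_congr _ fun n hn => hz n (by omega)]

/-- Adaptedness: for fixed levels, step `k` starts from a point determined by the samples up to
`T^k`. This is the invariance that the path estimates require. -/
theorem randGDIterate_stopPath (z : ℕ → S) (j : ℕ → ℕ) (k : ℕ) :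
    randGDIterate G γ B M x₀ (stopPath (sampleCount B j k) z) j k
      = randGDIterate G γ B M x₀ z j k :=
  (randGDIterate_congr k (fun _ _ => rfl) fun _ hn => (stopPath_apply_of_le hn z).symm).symm

theorem norm_batchGrad_le {a : ℝ} {x : EuclideanSpace ℝ (Fin d)} (ha : ∀ z, ‖G x z‖ ≤ a)
    (z : ℕ → S) (T i : ℕ) : ‖batchGrad G z B T x i‖ ≤ a := by
  have ha0 : 0 ≤ a := (norm_nonneg _).trans (ha (z 0))
  have h1 : ‖∑ n ∈ Finset.Icc 1 (2 ^ i * B), G x (z (T + n))‖ ≤ (2 ^ i * B : ℝ) * a := by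
    refine (norm_sum_le_of_le _ fun n _ => ha _).trans ?_
    simp
  unfold batchGrad
  rw [norm_smul, norm_inv, Real.norm_of_nonneg (by positivity)]
  rcases Nat.eq_zero_or_pos B with rfl | hB
  · simpa using ha0
  · rw [inv_mul_le_iff₀ (by positivity)]
    exact h1

theorem norm_randBatchGrad_le {a : ℝ} {x : EuclideanSpace ℝ (Fin d)} (ha : ∀ z, ‖G x z‖ ≤ a)
    (hM : 0 ≤ M) (z : ℕ → S) (T i : ℕ) : ‖randBatchGrad G z B M T x i‖ ≤ (1 + 2 * M) * a := by
  have ha0 : 0 ≤ a := (norm_nonneg _).trans (ha (z 0))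
  have hb := norm_batchGrad_le (B := B) ha z T
  unfold randBatchGrad
  refine (norm_add_le _ _).trans ?_
  rw [add_mul, one_mul]
  refine add_le_add (hb 0) ?_
  split_ifs with hi
  · rw [norm_smul, Real.norm_of_nonneg (by positivity)]
    have h1 : ‖batchGrad G z B T x i - batchGrad G z B T x (i - 1)‖ ≤ 2 * a :=
      (norm_sub_le _ _).trans (by linarith [hb i, hb (i - 1)])
    have := mul_le_mul hi h1 (norm_nonneg _) hM
    linarith
  · rw [norm_zero]
    positivity

/-- The truncation at `M` keeps the amplification `2^i` bounded, so linear growth of the field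
gives, for each `k`, a deterministic bound over all paths and levels. It need not be uniform in `k`:
it serves only integrability. -/
theorem exists_norm_randGDIterate_le (hM : 0 ≤ M) {a₀ a₁ : ℝ} (ha₁ : 0 ≤ a₁)
    (hG : ∀ x z, ‖G x z‖ ≤ a₀ + a₁ * ‖x‖) (k : ℕ) :
    ∃ C, ∀ z j, ‖randGDIterate G γ B M x₀ z j k‖ ≤ C := by
  induction k with
  | zero => exact ⟨‖x₀‖, fun _ _ => le_rfl⟩
  | succ k ih =>
    obtain ⟨C, hC⟩ := ih
    refine ⟨C + |γ| * ((1 + 2 * M) * (a₀ + a₁ * C)), fun z j => ?_⟩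
    rw [randGDIterate_succ]
    refine (norm_sub_le _ _).trans (add_le_add (hC z j) ?_)
    rw [norm_smul, Real.norm_eq_abs]
    refine mul_le_mul_of_nonneg_left (norm_randBatchGrad_le (fun w => (hG _ w).trans ?_)
      hM _ _ _) (abs_nonneg γ)
    gcongr
    exact hC z j

/-- The estimator at level `0`, and at all levels above the truncation, is the base batch. -/
theorem randBatchGrad_zero (z : ℕ → S) (T : ℕ) (x : EuclideanSpace ℝ (Fin d)) :
    randBatchGrad G z B M T x 0 = batchGrad G z B T x 0 := by
  simp [randBatchGrad]

theorem randBatchGrad_of_lt (z : ℕ → S) (T : ℕ) (x : EuclideanSpace ℝ (Fin d)) {i : ℕ}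
    (hi : M < 2 ^ i) : randBatchGrad G z B M T x i = batchGrad G z B T x 0 := by
  simp [randBatchGrad, not_le.2 hi]

theorem batchGrad_sub_eq (g x : EuclideanSpace ℝ (Fin d)) (z : ℕ → S) (T i : ℕ) (hB : 0 < B) :
    batchGrad G z B T x i - g
      = ((2 : ℝ) ^ i * B)⁻¹ • ∑ n ∈ Finset.Icc 1 (2 ^ i * B), (G x (z (T + n)) - g) := by
  have : ((2 : ℝ) ^ i * B) ≠ 0 := by positivity
  unfold batchGrad
  rw [Finset.sum_sub_distrib, smul_sub, Finset.sum_const, Nat.card_Icc, Nat.add_sub_cancel,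
    ← Nat.cast_smul_eq_nsmul ℝ, smul_smul]
  push_cast
  rw [inv_mul_cancel₀ this, one_smul]

variable [MeasurableSpace S]

theorem measurable_eval_path : Measurable fun q : (ℕ → S) × ℕ => q.1 q.2 :=
  measurable_from_prod_countable_left fun n => measurable_pi_apply n

theorem measurable_apply_level {α β : Type*} [MeasurableSpace α] [MeasurableSpace β]
    {φ : ℕ → α → β} (hφ : ∀ i, Measurable (φ i)) {j : α → ℕ} (hj : Measurable j) :
    Measurable fun a => φ (j a) a := by
  have h : Measurable fun q : α × ℕ => φ q.2 q.1 := measurable_from_prod_countable_left hφ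
  exact h.comp (measurable_id.prodMk hj)

theorem measurable_sampleCount (k : ℕ) : Measurable fun j => sampleCount B j k :=
  Finset.measurable_sum _ fun i _ =>
    (measurable_from_top (f := fun n : ℕ => 2 ^ n * B)).comp (measurable_pi_apply i)

theorem measurable_batchGrad (hG : Measurable fun p : EuclideanSpace ℝ (Fin d) × S => G p.1 p.2)
    {α : Type*} [MeasurableSpace α] {z : α → ℕ → S} {T : α → ℕ}
    {X : α → EuclideanSpace ℝ (Fin d)} (hz : Measurable z) (hT : Measurable T)
    (hX : Measurable X) (i : ℕ) : Measurable fun a => batchGrad G (z a) B (T a) (X a) i := by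
  have hsum : Measurable fun a => ∑ n ∈ Finset.Icc 1 (2 ^ i * B), G (X a) (z a (T a + n)) := by
    refine Finset.measurable_sum _ fun n _ => ?_
    exact hG.comp (hX.prodMk (measurable_eval_path.comp (hz.prodMk (hT.add_const n))))
  exact hsum.const_smul ((2 : ℝ) ^ i * (B : ℝ))⁻¹

theorem measurable_randBatchGrad
    (hG : Measurable fun p : EuclideanSpace ℝ (Fin d) × S => G p.1 p.2)
    {α : Type*} [MeasurableSpace α] {z : α → ℕ → S} {T : α → ℕ}
    {X : α → EuclideanSpace ℝ (Fin d)} (hz : Measurable z) (hT : Measurable T)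
    (hX : Measurable X) (i : ℕ) : Measurable fun a => randBatchGrad G (z a) B M (T a) (X a) i := by
  have h := measurable_batchGrad (B := B) hG hz hT hX
  unfold randBatchGrad
  refine (h 0).add ?_
  split_ifs
  · exact ((h i).sub (h (i - 1))).const_smul ((2 : ℝ) ^ i)
  · exact measurable_const

theorem measurable_randBatchGrad_level
    (hG : Measurable fun p : EuclideanSpace ℝ (Fin d) × S => G p.1 p.2)
    {α : Type*} [MeasurableSpace α] {z : α → ℕ → S} {T j : α → ℕ}
    {X : α → EuclideanSpace ℝ (Fin d)} (hz : Measurable z) (hT : Measurable T)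
    (hX : Measurable X) (hj : Measurable j) :
    Measurable fun a => randBatchGrad G (z a) B M (T a) (X a) (j a) := by
  exact measurable_apply_level (φ := fun i a => randBatchGrad G (z a) B M (T a) (X a) i)
    (fun i => measurable_randBatchGrad hG hz hT hX i) hj

theorem measurable_randGDIterate
    (hG : Measurable fun p : EuclideanSpace ℝ (Fin d) × S => G p.1 p.2) (k : ℕ) :
    Measurable fun p : (ℕ → S) × (ℕ → ℕ) => randGDIterate G γ B M x₀ p.1 p.2 k := by
  induction k with
  | zero => exact measurable_const
  | succ k ih =>
    simp only [randGDIterate_succ]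
    exact ih.sub ((measurable_randBatchGrad_level hG measurable_fst
      ((measurable_sampleCount k).comp measurable_snd) ih
      ((measurable_pi_apply k).comp measurable_snd)).const_smul γ)

end Iterates

/-! ### Averaging over the independent geometric levels -/

section Averaging

variable {S Ω : Type*} [MeasurableSpace S] [MeasurableSpace Ω] {P : Measure Ω}
  {Z : ℕ → Ω → S} {J : ℕ → Ω → ℕ}

/-- The first `k` entries of `j`, followed by zeros. -/
def truncSeq (k : ℕ) (j : ℕ → ℕ) : ℕ → ℕ := fun i => if i < k then j i else 0

theorem measurable_truncSeq (k : ℕ) : Measurable (truncSeq k) := by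
  refine measurable_pi_iff.2 fun i => ?_
  unfold truncSeq
  split_ifs
  · exact measurable_pi_apply i
  · exact measurable_const

theorem IsGeometricSampling.indepFun_truncSeq (hJ : IsGeometricSampling P Z J) (k : ℕ) :
    IndepFun (J k) (fun ω => truncSeq k fun i => J i ω) P := by
  -- Mutual independence separates the block `{k}` from the block `0, …, k - 1`; the map `e` below
  -- rebuilds the truncated sequence from the second block.
  have h := hJ.iIndep.indepFun_finset {k} (Finset.range k) (by simp) hJ.measurable
  let e : (Finset.range k → ℕ) → ℕ → ℕ := fun a i =>
    if hi : i < k then a ⟨i, Finset.mem_range.2 hi⟩ else 0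
  have he : Measurable e := by
    refine measurable_pi_iff.2 fun i => ?_
    by_cases hi : i < k
    · simpa only [e, hi, dif_pos] using measurable_pi_apply _
    · simpa only [e, hi, dif_neg, not_false_eq_true] using measurable_const
  have hp : Measurable fun a : (({k} : Finset ℕ) → ℕ) => a ⟨k, Finset.mem_singleton_self k⟩ :=
    measurable_pi_apply (X := fun _ : ({k} : Finset ℕ) => ℕ) _
  exact h.comp hp he

variable [IsProbabilityMeasure P]

theorem IsGeometricSampling.map_pair (hJ : IsGeometricSampling P Z J)
    (hZ : ∀ n, Measurable (Z n)) :
    P.map (fun ω => ((fun n => Z n ω), fun n => J n ω))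
      = (P.map fun ω n => Z n ω).prod (P.map fun ω n => J n ω) :=
  (indepFun_iff_map_prod_eq_prod_map_map (measurable_pi_iff.2 hZ).aemeasurable
    (measurable_pi_iff.2 hJ.measurable).aemeasurable).1 hJ.indep

/-- Comparison of expectations, conditionally on the levels. -/
theorem IsGeometricSampling.integral_le_of_forall_level (hJ : IsGeometricSampling P Z J)
    (hZ : ∀ n, Measurable (Z n)) {H H' : (ℕ → S) × (ℕ → ℕ) → ℝ} (hH : Measurable H)
    (hH' : Measurable H') {R R' : ℝ} (hR : ∀ p, ‖H p‖ ≤ R) (hR' : ∀ p, ‖H' p‖ ≤ R') (c : ℝ)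
    (h : ∀ j, ∫ z, H (z, j) ∂(P.map fun ω n => Z n ω)
      ≤ c * ∫ z, H' (z, j) ∂(P.map fun ω n => Z n ω)) :
    ∫ ω, H (fun n => Z n ω, fun n => J n ω) ∂P
      ≤ c * ∫ ω, H' (fun n => Z n ω, fun n => J n ω) ∂P := by
  have hZm : Measurable fun ω n => Z n ω := measurable_pi_iff.2 hZ
  have hJm : Measurable fun ω n => J n ω := measurable_pi_iff.2 hJ.measurable
  have := Measure.isProbabilityMeasure_map (μ := P) hZm.aemeasurable
  have := Measure.isProbabilityMeasure_map (μ := P) hJm.aemeasurable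
  have hi : Integrable H ((P.map fun ω n => Z n ω).prod (P.map fun ω n => J n ω)) :=
    integrable_of_measurable_of_norm_le hH R hR
  have hi' : Integrable H' ((P.map fun ω n => Z n ω).prod (P.map fun ω n => J n ω)) :=
    integrable_of_measurable_of_norm_le hH' R' hR'
  -- Under the product law, Fubini with the levels outermost reduces the claim to fixed `j`, where
  -- the sample times are deterministic.
  rw [← integral_map (hZm.prodMk hJm).aemeasurable hH.aestronglyMeasurable,
    ← integral_map (hZm.prodMk hJm).aemeasurable hH'.aestronglyMeasurable, hJ.map_pair hZ,
    integral_prod_symm _ hi, integral_prod_symm _ hi', ← integral_const_mul]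
  exact integral_mono hi.integral_prod_right (hi'.integral_prod_right.const_mul c) h

theorem IsGeometricSampling.integral_indicator_level (hJ : IsGeometricSampling P Z J)
    (hZ : ∀ n, Measurable (Z n)) (k : ℕ) {H : (ℕ → S) × (ℕ → ℕ) → ℝ} (hH : Measurable H)
    {R : ℝ} (hR : ∀ p, ‖H p‖ ≤ R) (hk : ∀ z j, H (z, truncSeq k j) = H (z, j)) {i : ℕ}
    (hi : 1 ≤ i) :
    ∫ ω, ({i} : Set ℕ).indicator (fun _ => (1 : ℝ)) (J k ω)
        * H (fun n => Z n ω, fun n => J n ω) ∂P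
      = (1 / 2) ^ i * ∫ ω, H (fun n => Z n ω, fun n => J n ω) ∂P := by
  have hZm : Measurable fun ω n => Z n ω := measurable_pi_iff.2 hZ
  have hJm : Measurable fun ω n => J n ω := measurable_pi_iff.2 hJ.measurable
  have := Measure.isProbabilityMeasure_map (μ := P) hZm.aemeasurable
  have := Measure.isProbabilityMeasure_map (μ := P) hJm.aemeasurable
  set χ : ℕ → ℝ := ({i} : Set ℕ).indicator (fun _ => (1 : ℝ))
  have hχ : Measurable χ := measurable_of_countable _
  have hχ1 : ∀ n, ‖χ n‖ ≤ 1 := fun n => by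
    simp only [χ, Set.indicator]
    split_ifs <;> simp
  have hH1 : Measurable fun p : (ℕ → S) × (ℕ → ℕ) => χ (p.2 k) * H p :=
    (hχ.comp ((measurable_pi_apply k).comp measurable_snd)).mul hH
  have hiH : Integrable H ((P.map fun ω n => Z n ω).prod (P.map fun ω n => J n ω)) :=
    integrable_of_measurable_of_norm_le hH R hR
  have hiH1 : Integrable (fun p : (ℕ → S) × (ℕ → ℕ) => χ (p.2 k) * H p)
      ((P.map fun ω n => Z n ω).prod (P.map fun ω n => J n ω)) := by
    refine integrable_of_measurable_of_norm_le hH1 R fun p => ?_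
    rw [norm_mul]
    exact (mul_le_of_le_one_left (norm_nonneg _) (hχ1 _)).trans (hR p)
  have hχP : ∫ ω, χ (J k ω) ∂P = (1 / 2) ^ i := by
    have : (fun ω => χ (J k ω)) = (J k ⁻¹' {i}).indicator fun _ => (1 : ℝ) := rfl
    rw [this, integral_indicator_const _ (hJ.measurable k (measurableSet_singleton i)),
      smul_eq_mul, mul_one, measureReal_def, hJ.law k i hi]
    simp
  -- For a fixed path, `H` depends only on the first `k` levels and is thus independent of `J k`.
  have key : ∀ z, ∫ j, χ (j k) * H (z, j) ∂(P.map fun ω n => J n ω)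
      = (1 / 2) ^ i * ∫ j, H (z, j) ∂(P.map fun ω n => J n ω) := by
    intro z
    have hHz : Measurable fun j => H (z, j) := hH.comp measurable_prodMk_left
    have hH1z : Measurable fun j => χ (j k) * H (z, j) := hH1.comp measurable_prodMk_left
    rw [integral_map hJm.aemeasurable hH1z.aestronglyMeasurable,
      integral_map hJm.aemeasurable hHz.aestronglyMeasurable, ← hχP]
    have h1 := ((hJ.indepFun_truncSeq k).comp hχ hHz).integral_fun_mul_eq_mul_integral
      (hχ.comp (hJ.measurable k)).aestronglyMeasurable
      (hHz.comp ((measurable_truncSeq k).comp hJm)).aestronglyMeasurable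
    simpa only [Function.comp_apply, hk] using h1
  have e1 := integral_map (μ := P) (hZm.prodMk hJm).aemeasurable hH1.aestronglyMeasurable
  have e2 := integral_map (μ := P) (hZm.prodMk hJm).aemeasurable hH.aestronglyMeasurable
  rw [hJ.map_pair hZ, integral_prod _ hiH1] at e1
  rw [hJ.map_pair hZ, integral_prod _ hiH] at e2
  simp only [key, integral_const_mul] at e1
  rw [← e2, e1]

/-- Averaging over the level `J k`, for a family of observables that depends on the earlier levels
only and is constant above the level `K`. -/
theorem IsGeometricSampling.integral_level (hJ : IsGeometricSampling P Z J)
    (hZ : ∀ n, Measurable (Z n)) (k K : ℕ) {H : ℕ → (ℕ → S) × (ℕ → ℕ) → ℝ}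
    (hH : ∀ i, Measurable (H i)) {R : ℝ} (hR : ∀ i p, ‖H i p‖ ≤ R)
    (hk : ∀ i z j, H i (z, truncSeq k j) = H i (z, j)) (hK : ∀ i p, K < i → H i p = H 0 p) :
    ∫ ω, H (J k ω) (fun n => Z n ω, fun n => J n ω) ∂P
      = ∫ ω, H 0 (fun n => Z n ω, fun n => J n ω) ∂P
        + ∑ i ∈ Finset.Icc 1 K, (1 / 2) ^ i *
          (∫ ω, H i (fun n => Z n ω, fun n => J n ω) ∂P
            - ∫ ω, H 0 (fun n => Z n ω, fun n => J n ω) ∂P) := by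
  have hZm : Measurable fun ω n => Z n ω := measurable_pi_iff.2 hZ
  have hJm : Measurable fun ω n => J n ω := measurable_pi_iff.2 hJ.measurable
  set Y : Ω → (ℕ → S) × (ℕ → ℕ) := fun ω => (fun n => Z n ω, fun n => J n ω)
  have hY : Measurable Y := hZm.prodMk hJm
  have hiH : ∀ i, Integrable (fun ω => H i (Y ω)) P := fun i =>
    integrable_of_measurable_of_norm_le ((hH i).comp hY) R fun ω => hR i _
  -- The value `H 0` serves as the default for every level outside `1, …, K`. The identity is
  -- pointwise, so neither the tail probability nor that of the level `0` is needed.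
  have hid : ∀ ω, H (J k ω) (Y ω) = H 0 (Y ω) + ∑ i ∈ Finset.Icc 1 K,
      ({i} : Set ℕ).indicator (fun _ => (1 : ℝ)) (J k ω) * (H i (Y ω) - H 0 (Y ω)) := by
    intro ω
    rw [← sub_eq_iff_eq_add', Finset.sum_eq_single (J k ω)]
    · simp
    · intro i _ hi
      simp [Set.indicator, hi.symm]
    · intro hn
      rcases Nat.eq_zero_or_pos (J k ω) with h0 | h0
      · simp [h0]
      · rw [hK _ _ (by by_contra hc; exact hn (Finset.mem_Icc.2 ⟨h0, not_lt.1 hc⟩))]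
        simp
  have hint : ∀ i, Integrable (fun ω => ({i} : Set ℕ).indicator (fun _ => (1 : ℝ)) (J k ω)
      * (H i (Y ω) - H 0 (Y ω))) P := by
    intro i
    refine Integrable.bdd_mul (c := 1) ((hiH i).sub (hiH 0))
      ((measurable_of_countable (({i} : Set ℕ).indicator fun _ => (1 : ℝ))).comp
        (hJ.measurable k)).aestronglyMeasurable (Filter.Eventually.of_forall fun ω => ?_)
    simp only [Set.indicator]
    split_ifs <;> simp
  refine (integral_congr_ae (Filter.Eventually.of_forall hid)).trans ?_
  rw [integral_add (hiH 0) (integrable_finsetSum _ fun i _ => hint i),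
    integral_finsetSum _ fun i _ => hint i]
  congr 1
  refine Finset.sum_congr rfl fun i hi => ?_
  rw [hJ.integral_indicator_level hZ k (H := fun p => H i p - H 0 p) ((hH i).sub (hH 0))
    (R := R + R) (fun p => (norm_sub_le _ _).trans (add_le_add (hR i p) (hR 0 p)))
    (fun z j => by rw [hk, hk]) (Finset.mem_Icc.1 hi).1, integral_sub (hiH i) (hiH 0)]

end Averaging

/-! ### The abstract Markov model and errors at a fixed level -/

section Model

variable {d : ℕ} {S Ω : Type*}
  {G : EuclideanSpace ℝ (Fin d) → S → EuclideanSpace ℝ (Fin d)}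
  {g : EuclideanSpace ℝ (Fin d) → EuclideanSpace ℝ (Fin d)} {r : EuclideanSpace ℝ (Fin d) → ℝ}
  {γ : ℝ} {B : ℕ} {M : ℝ} {x₀ : EuclideanSpace ℝ (Fin d)}

/-- The deviation of the stochastic field `G` from its mean `g`. -/
def deviation (G : EuclideanSpace ℝ (Fin d) → S → EuclideanSpace ℝ (Fin d))
    (g : EuclideanSpace ℝ (Fin d) → EuclideanSpace ℝ (Fin d))
    (x : EuclideanSpace ℝ (Fin d)) (z : S) : EuclideanSpace ℝ (Fin d) := G x z - g x

theorem batchGrad_deviation (hB : 0 < B) (z : ℕ → S) (T : ℕ) (x : EuclideanSpace ℝ (Fin d))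
    (i : ℕ) : batchGrad (deviation G g) z B T x i = batchGrad G z B T x i - g x :=
  (batchGrad_sub_eq (g x) x z T i hB).symm

/-- The mean enters once, through the base batch, and cancels in the difference of consecutive
levels; the estimator error is therefore the same estimator applied to the deviations. -/
theorem randBatchGrad_eq_add_deviation (hB : 0 < B) (z : ℕ → S) (T : ℕ)
    (x : EuclideanSpace ℝ (Fin d)) (i : ℕ) :
    randBatchGrad G z B M T x i = g x + randBatchGrad (deviation G g) z B M T x i := by
  simp only [randBatchGrad, batchGrad_deviation hB, sub_sub_sub_cancel_right]
  abel

/-- The batch mean of the deviations at level `i` in step `k` of the method. -/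
def batchError (G : EuclideanSpace ℝ (Fin d) → S → EuclideanSpace ℝ (Fin d))
    (g : EuclideanSpace ℝ (Fin d) → EuclideanSpace ℝ (Fin d)) (γ : ℝ) (B : ℕ) (M : ℝ)
    (x₀ : EuclideanSpace ℝ (Fin d)) (k i : ℕ) (p : (ℕ → S) × (ℕ → ℕ)) :
    EuclideanSpace ℝ (Fin d) :=
  batchGrad (deviation G g) p.1 B (sampleCount B p.2 k) (randGDIterate G γ B M x₀ p.1 p.2 k) i

/-- The error of the randomized estimator with level `i` in step `k` of the method. -/
def randBatchError (G : EuclideanSpace ℝ (Fin d) → S → EuclideanSpace ℝ (Fin d))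
    (g : EuclideanSpace ℝ (Fin d) → EuclideanSpace ℝ (Fin d)) (γ : ℝ) (B : ℕ) (M : ℝ)
    (x₀ : EuclideanSpace ℝ (Fin d)) (k i : ℕ) (p : (ℕ → S) × (ℕ → ℕ)) :
    EuclideanSpace ℝ (Fin d) :=
  randBatchGrad (deviation G g) p.1 B M (sampleCount B p.2 k)
    (randGDIterate G γ B M x₀ p.1 p.2 k) i

theorem batchError_eq_smul_sum (k i : ℕ) (p : (ℕ → S) × (ℕ → ℕ)) :
    batchError G g γ B M x₀ k i p = ((2 : ℝ) ^ i * B)⁻¹ • ∑ n ∈ Finset.Icc 1 (2 ^ i * B),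
      deviation G g (randGDIterate G γ B M x₀ p.1 p.2 k) (p.1 (sampleCount B p.2 k + n)) := rfl

theorem randBatchError_of_le (k : ℕ) {i : ℕ} (hi : (2 : ℝ) ^ i ≤ M) (p : (ℕ → S) × (ℕ → ℕ)) :
    randBatchError G g γ B M x₀ k i p = batchError G g γ B M x₀ k 0 p
      + (2 : ℝ) ^ i • (batchError G g γ B M x₀ k i p - batchError G g γ B M x₀ k (i - 1) p) := by
  simp only [randBatchError, batchError, randBatchGrad, if_pos hi]

theorem randBatchError_zero (k : ℕ) (p : (ℕ → S) × (ℕ → ℕ)) :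
    randBatchError G g γ B M x₀ k 0 p = batchError G g γ B M x₀ k 0 p :=
  randBatchGrad_zero _ _ _

theorem randBatchError_of_lt (k : ℕ) {i : ℕ} (hi : M < (2 : ℝ) ^ i) (p : (ℕ → S) × (ℕ → ℕ)) :
    randBatchError G g γ B M x₀ k i p = randBatchError G g γ B M x₀ k 0 p :=
  (randBatchGrad_of_lt _ _ _ hi).trans (randBatchGrad_zero _ _ _).symm

theorem randGDIterate_truncSeq (z : ℕ → S) (j : ℕ → ℕ) (k : ℕ) :
    randGDIterate G γ B M x₀ z (truncSeq k j) k = randGDIterate G γ B M x₀ z j k :=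
  randGDIterate_congr k (fun i hi => by simp [truncSeq, hi]) fun _ _ => rfl

theorem randBatchError_truncSeq (k i : ℕ) (z : ℕ → S) (j : ℕ → ℕ) :
    randBatchError G g γ B M x₀ k i (z, truncSeq k j) = randBatchError G g γ B M x₀ k i (z, j) := by
  have hT : sampleCount B (truncSeq k j) k = sampleCount B j k :=
    Finset.sum_congr rfl fun i hi => by simp [truncSeq, Finset.mem_range.1 hi]
  simp only [randBatchError, randGDIterate_truncSeq, hT]

variable [MeasurableSpace S] [MeasurableSpace Ω]

/-- A stochastic field `G` with mean `g` and deviation at most `r`, driven by a stationary mixing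
Markov chain `Z` and independent geometric levels `J`. -/
structure IsMarkovModel (P : Measure Ω) (Q : Kernel S S) [IsMarkovKernel Q] (π : Measure S)
    (τ : ℕ) (Z : ℕ → Ω → S) (J : ℕ → Ω → ℕ)
    (G : EuclideanSpace ℝ (Fin d) → S → EuclideanSpace ℝ (Fin d))
    (g : EuclideanSpace ℝ (Fin d) → EuclideanSpace ℝ (Fin d))
    (r : EuclideanSpace ℝ (Fin d) → ℝ) : Prop where
  sampling : IsGeometricSampling P Z J
  chain : IsMarkovChain P Q π Z
  isProbabilityMeasure : IsProbabilityMeasure π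
  invariant : Kernel.Invariant Q π
  mixing : HasMixingTime Q τ
  noise : IsCenteredNoise π (deviation G g) r
  measurable_field : Measurable fun p : EuclideanSpace ℝ (Fin d) × S => G p.1 p.2
  continuous_mean : Continuous g
  continuous_bound : Continuous r
  growth : ∃ a₀ a₁ : ℝ, 0 ≤ a₁ ∧ ∀ x z, ‖G x z‖ ≤ a₀ + a₁ * ‖x‖

/-- The sample path of the chain and of the levels. -/
def samplePath (Z : ℕ → Ω → S) (J : ℕ → Ω → ℕ) (ω : Ω) : (ℕ → S) × (ℕ → ℕ) :=
  (fun n => Z n ω, fun n => J n ω)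

variable {P : Measure Ω} {Q : Kernel S S} [IsMarkovKernel Q]
  {π : Measure S} {τ : ℕ} {Z : ℕ → Ω → S} {J : ℕ → Ω → ℕ}

namespace IsMarkovModel

theorem measurable_samplePath (h : IsMarkovModel P Q π τ Z J G g r) :
    Measurable (samplePath Z J) :=
  (measurable_pi_iff.2 h.chain.measurable).prodMk (measurable_pi_iff.2 h.sampling.measurable)

theorem exists_bound_comp_iterate (h : IsMarkovModel P Q π τ Z J G g r) (hM : 0 ≤ M)
    {F : Type*} [SeminormedAddCommGroup F] {φ : EuclideanSpace ℝ (Fin d) → F}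
    (hφ : Continuous φ) (k : ℕ) :
    ∃ R, ∀ z j, ‖φ (randGDIterate G γ B M x₀ z j k)‖ ≤ R := by
  obtain ⟨a₀, a₁, ha₁, hG⟩ := h.growth
  obtain ⟨C, hC⟩ := exists_norm_randGDIterate_le (γ := γ) (B := B) (x₀ := x₀) hM ha₁ hG k
  obtain ⟨R, hR⟩ := (isCompact_closedBall (0 : EuclideanSpace ℝ (Fin d))
    C).exists_bound_of_continuousOn hφ.continuousOn
  exact ⟨R, fun z j => hR _ (by simpa using hC z j)⟩

theorem measurable_randBatchError (h : IsMarkovModel P Q π τ Z J G g r) (k i : ℕ) :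
    Measurable (randBatchError (S := S) G g γ B M x₀ k i) :=
  measurable_randBatchGrad h.noise.measurable measurable_fst
    ((measurable_sampleCount k).comp measurable_snd)
    (measurable_randGDIterate h.measurable_field k) i

theorem measurable_batchError (h : IsMarkovModel P Q π τ Z J G g r) (k i : ℕ) :
    Measurable (batchError (S := S) G g γ B M x₀ k i) :=
  measurable_batchGrad h.noise.measurable measurable_fst
    ((measurable_sampleCount k).comp measurable_snd)
    (measurable_randGDIterate h.measurable_field k) i

theorem norm_batchError_le (h : IsMarkovModel P Q π τ Z J G g r) (k i : ℕ)
    (p : (ℕ → S) × (ℕ → ℕ)) :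
    ‖batchError G g γ B M x₀ k i p‖ ≤ r (randGDIterate G γ B M x₀ p.1 p.2 k) :=
  norm_batchGrad_le (h.noise.norm_le _) _ _ _

theorem exists_norm_batchError_le (h : IsMarkovModel P Q π τ Z J G g r) (hM : 0 ≤ M) (k : ℕ) :
    ∃ R, 0 ≤ R ∧ ∀ i (p : (ℕ → S) × (ℕ → ℕ)), ‖batchError G g γ B M x₀ k i p‖ ≤ R := by
  obtain ⟨R, hR⟩ := h.exists_bound_comp_iterate (γ := γ) (B := B) (x₀ := x₀) hM
    h.continuous_bound k
  exact ⟨|R|, abs_nonneg _, fun i p => (h.norm_batchError_le k i p).trans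
    ((Real.le_norm_self _).trans ((hR _ _).trans (le_abs_self R)))⟩

theorem exists_norm_randBatchError_le (h : IsMarkovModel P Q π τ Z J G g r) (hM : 0 ≤ M)
    (k : ℕ) :
    ∃ R, 0 ≤ R ∧ ∀ i (p : (ℕ → S) × (ℕ → ℕ)), ‖randBatchError G g γ B M x₀ k i p‖ ≤ R := by
  obtain ⟨R, hR⟩ := h.exists_bound_comp_iterate (γ := γ) (B := B) (x₀ := x₀) hM
    h.continuous_bound k
  refine ⟨|(1 + 2 * M) * R|, abs_nonneg _, fun i p => ?_⟩
  refine (norm_randBatchGrad_le (h.noise.norm_le _) hM _ _ _).trans (le_trans ?_ (le_abs_self _))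
  gcongr
  exact (Real.le_norm_self _).trans (hR _ _)

variable [IsProbabilityMeasure P]

theorem integrable_comp_iterate (h : IsMarkovModel P Q π τ Z J G g r) (hM : 0 ≤ M)
    {φ : EuclideanSpace ℝ (Fin d) → ℝ} (hφ : Continuous φ) (k : ℕ) :
    Integrable (fun ω => φ (randGDIterate G γ B M x₀ (samplePath Z J ω).1
      (samplePath Z J ω).2 k)) P := by
  obtain ⟨R, hR⟩ := h.exists_bound_comp_iterate (γ := γ) (B := B) (x₀ := x₀) hM hφ k
  exact integrable_of_measurable_of_norm_le (hφ.measurable.comp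
    ((measurable_randGDIterate h.measurable_field k).comp h.measurable_samplePath)) R
    fun ω => hR _ _

/-- Mean squared error of the batch mean at a fixed level. -/
theorem integral_norm_batchError_sq_le (h : IsMarkovModel P Q π τ Z J G g r) (hM : 0 ≤ M)
    (hB : 0 < B) (k i : ℕ) :
    ∫ ω, ‖batchError G g γ B M x₀ k i (samplePath Z J ω)‖ ^ 2 ∂P
      ≤ 16 / 3 * τ / (2 ^ i * B) * ∫ ω, r (randGDIterate G γ B M x₀ (samplePath Z J ω).1
        (samplePath Z J ω).2 k) ^ 2 ∂P := by
  have hZm : Measurable fun ω n => Z n ω := measurable_pi_iff.2 h.chain.measurable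
  have := Measure.isProbabilityMeasure_map (μ := P) hZm.aemeasurable
  have := h.isProbabilityMeasure
  obtain ⟨R, hR0, hR⟩ := h.exists_norm_batchError_le (γ := γ) (B := B) (x₀ := x₀) hM k
  obtain ⟨R', hR'⟩ := h.exists_bound_comp_iterate (γ := γ) (B := B) (x₀ := x₀) hM
    h.continuous_bound k
  have hX := measurable_randGDIterate (γ := γ) (B := B) (M := M) (x₀ := x₀) h.measurable_field k
  refine h.sampling.integral_le_of_forall_level h.chain.measurable
    (H := fun p => ‖batchError G g γ B M x₀ k i p‖ ^ 2)
    (H' := fun p => r (randGDIterate G γ B M x₀ p.1 p.2 k) ^ 2)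
    ((h.measurable_batchError k i).norm.pow_const 2)
    ((h.continuous_bound.measurable.comp hX).pow_const 2)
    (R := R ^ 2) (R' := R' ^ 2) (fun p => ?_) (fun p => ?_) _ fun j => ?_
  · rw [norm_pow, norm_norm]
    exact pow_le_pow_left₀ (norm_nonneg _) (hR i p) 2
  · rw [norm_pow]
    exact pow_le_pow_left₀ (norm_nonneg _) (hR' _ _) 2
  · have hXj : Measurable fun z => randGDIterate G γ B M x₀ z j k :=
      hX.comp measurable_prodMk_right
    have h1 := h.chain.isMarkovPathLaw.integral_norm_sum_noise_sq_le h.mixing h.invariant h.noise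
      (t := sampleCount B j k) (2 ^ i * B) hXj (fun z => (Real.le_norm_self _).trans (hR' z j))
      (fun z => randGDIterate_stopPath z j k)
    simp only [batchError_eq_smul_sum, norm_smul, mul_pow]
    rw [integral_const_mul]
    have hn : (0 : ℝ) < 2 ^ i * B := by positivity
    refine (mul_le_mul_of_nonneg_left h1 (by positivity)).trans (le_of_eq ?_)
    rw [norm_inv, Real.norm_of_nonneg hn.le]
    push_cast
    field_simp

/-- Bias of the batch mean at a fixed level. -/
theorem integral_inner_batchError_le (h : IsMarkovModel P Q π τ Z J G g r) (hM : 0 ≤ M)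
    (hB : 0 < B) (k i : ℕ) :
    ∫ ω, inner ℝ (-g (randGDIterate G γ B M x₀ (samplePath Z J ω).1 (samplePath Z J ω).2 k))
        (batchError G g γ B M x₀ k i (samplePath Z J ω)) ∂P
      ≤ 8 / 3 * τ / (2 ^ i * B) * ∫ ω,
        ‖g (randGDIterate G γ B M x₀ (samplePath Z J ω).1 (samplePath Z J ω).2 k)‖
        * r (randGDIterate G γ B M x₀ (samplePath Z J ω).1 (samplePath Z J ω).2 k) ∂P := by
  have hZm : Measurable fun ω n => Z n ω := measurable_pi_iff.2 h.chain.measurable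
  have := Measure.isProbabilityMeasure_map (μ := P) hZm.aemeasurable
  have := h.isProbabilityMeasure
  obtain ⟨R, hR0, hR⟩ := h.exists_norm_batchError_le (γ := γ) (B := B) (x₀ := x₀) hM k
  obtain ⟨R', hR'⟩ := h.exists_bound_comp_iterate (γ := γ) (B := B) (x₀ := x₀) hM
    h.continuous_bound k
  obtain ⟨C, hC⟩ := h.exists_bound_comp_iterate (γ := γ) (B := B) (x₀ := x₀) hM
    h.continuous_mean k
  have hX := measurable_randGDIterate (γ := γ) (B := B) (M := M) (x₀ := x₀) h.measurable_field k
  have hgX := h.continuous_mean.measurable.comp hX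
  have hC0 : ∀ z : ℕ → S, 0 ≤ C := fun z => (norm_nonneg _).trans (hC z fun _ => 0)
  refine h.sampling.integral_le_of_forall_level h.chain.measurable
    (H := fun p => inner ℝ (-g (randGDIterate G γ B M x₀ p.1 p.2 k))
      (batchError G g γ B M x₀ k i p))
    (H' := fun p => ‖g (randGDIterate G γ B M x₀ p.1 p.2 k)‖
      * r (randGDIterate G γ B M x₀ p.1 p.2 k))
    (hgX.neg.inner (h.measurable_batchError k i))
    (hgX.norm.mul (h.continuous_bound.measurable.comp hX))
    (R := C * R) (R' := C * R') (fun p => ?_) (fun p => ?_) _ fun j => ?_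
  · refine (norm_inner_le_norm _ _).trans ?_
    rw [norm_neg]
    exact mul_le_mul (hC _ _) (hR i p) (norm_nonneg _) (hC0 p.1)
  · rw [norm_mul, norm_norm]
    exact mul_le_mul (hC _ _) (hR' _ _) (norm_nonneg _) (hC0 p.1)
  · have hXj : Measurable fun z => randGDIterate G γ B M x₀ z j k :=
      hX.comp measurable_prodMk_right
    have h1 := h.chain.isMarkovPathLaw.integral_inner_sum_noise_le h.mixing h.invariant h.noise
      (t := sampleCount B j k) (2 ^ i * B)
      (ψ := fun z => -g (randGDIterate G γ B M x₀ z j k))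
      (h.continuous_mean.measurable.comp hXj).neg hXj
      (fun z => by rw [norm_neg]; exact hC z j)
      (fun z => (Real.le_norm_self _).trans (hR' z j))
      (fun z => by rw [randGDIterate_stopPath z j k]) (fun z => randGDIterate_stopPath z j k)
    simp only [batchError_eq_smul_sum, inner_smul_right]
    rw [integral_const_mul]
    have hn : (0 : ℝ) < 2 ^ i * B := by positivity
    refine (mul_le_mul_of_nonneg_left h1 (by positivity)).trans (le_of_eq ?_)
    simp only [norm_neg]
    field_simp

end IsMarkovModel

end Model

/-! ### Second moment and bias of the randomized estimator -/

section Step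

variable {d : ℕ} {S Ω : Type*} [MeasurableSpace S] [MeasurableSpace Ω]
  {G : EuclideanSpace ℝ (Fin d) → S → EuclideanSpace ℝ (Fin d)}
  {g : EuclideanSpace ℝ (Fin d) → EuclideanSpace ℝ (Fin d)} {r : EuclideanSpace ℝ (Fin d) → ℝ}
  {γ : ℝ} {B : ℕ} {M : ℝ} {x₀ : EuclideanSpace ℝ (Fin d)}
  {P : Measure Ω} [IsProbabilityMeasure P] {Q : Kernel S S} [IsMarkovKernel Q]
  {π : Measure S} {τ : ℕ} {Z : ℕ → Ω → S} {J : ℕ → Ω → ℕ}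

theorem sum_Icc_half_pow (K : ℕ) : ∑ i ∈ Finset.Icc 1 K, (1 / 2 : ℝ) ^ i = 1 - (1 / 2) ^ K := by
  induction K with
  | zero => simp
  | succ K ih =>
    rw [Finset.sum_Icc_succ_top (by omega), ih, pow_succ]
    ring

theorem norm_add_smul_sub_sq_le {E : Type*} [NormedAddCommGroup E] [NormedSpace ℝ E]
    (a b c : E) (t : ℝ) :
    ‖a + t • (b - c)‖ ^ 2 ≤ 2 * ‖a‖ ^ 2 + 4 * t ^ 2 * (‖b‖ ^ 2 + ‖c‖ ^ 2) := by
  have h1 : ‖a + t • (b - c)‖ ≤ ‖a‖ + |t| * (‖b‖ + ‖c‖) := by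
    refine (norm_add_le _ _).trans (add_le_add le_rfl ?_)
    rw [norm_smul, Real.norm_eq_abs]
    exact mul_le_mul_of_nonneg_left (norm_sub_le _ _) (abs_nonneg t)
  have h2 := pow_le_pow_left₀ (norm_nonneg _) h1 2
  have h3 : (|t| * (‖b‖ + ‖c‖)) ^ 2 ≤ 2 * t ^ 2 * (‖b‖ ^ 2 + ‖c‖ ^ 2) := by
    rw [mul_pow, sq_abs, mul_comm 2 (t ^ 2), mul_assoc]
    exact mul_le_mul_of_nonneg_left (by nlinarith [sq_nonneg (‖b‖ - ‖c‖)]) (sq_nonneg t)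
  nlinarith [sq_nonneg (‖a‖ - |t| * (‖b‖ + ‖c‖))]

theorem integral_mul_add_mul_add {α : Type*} [MeasurableSpace α] {μ : Measure α} {a b c : α → ℝ}
    (ha : Integrable a μ) (hb : Integrable b μ) (hc : Integrable c μ) (s t : ℝ) :
    ∫ ω, (s * a ω + t * (b ω + c ω)) ∂μ
      = s * ∫ ω, a ω ∂μ + t * (∫ ω, b ω ∂μ + ∫ ω, c ω ∂μ) := by
  have hbc : Integrable (fun ω => b ω + c ω) μ := hb.add hc
  rw [integral_add (ha.const_mul s) (hbc.const_mul t), integral_const_mul, integral_const_mul,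
    integral_add hb hc]

theorem integral_add_mul_sub {α : Type*} [MeasurableSpace α] {μ : Measure α} {a b c : α → ℝ}
    (ha : Integrable a μ) (hb : Integrable b μ) (hc : Integrable c μ) (t : ℝ) :
    ∫ ω, (a ω + t * (b ω - c ω)) ∂μ
      = ∫ ω, a ω ∂μ + t * (∫ ω, b ω ∂μ - ∫ ω, c ω ∂μ) := by
  have hbc : Integrable (fun ω => b ω - c ω) μ := hb.sub hc
  rw [integral_add ha (hbc.const_mul t), integral_const_mul, integral_sub hb hc]

namespace IsMarkovModel

theorem integrable_norm_batchError_sq (h : IsMarkovModel P Q π τ Z J G g r) (hM : 0 ≤ M)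
    (k i : ℕ) :
    Integrable (fun ω => ‖batchError G g γ B M x₀ k i (samplePath Z J ω)‖ ^ 2) P := by
  obtain ⟨R, hR0, hR⟩ := h.exists_norm_batchError_le (γ := γ) (B := B) (x₀ := x₀) hM k
  refine integrable_of_measurable_of_norm_le
    (((h.measurable_batchError k i).comp h.measurable_samplePath).norm.pow_const 2) (R ^ 2)
    fun ω => ?_
  rw [norm_pow, norm_norm]
  exact pow_le_pow_left₀ (norm_nonneg _) (hR i _) 2

theorem integrable_inner_batchError (h : IsMarkovModel P Q π τ Z J G g r) (hM : 0 ≤ M)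
    (k i : ℕ) :
    Integrable (fun ω => inner ℝ
      (-g (randGDIterate G γ B M x₀ (samplePath Z J ω).1 (samplePath Z J ω).2 k))
      (batchError G g γ B M x₀ k i (samplePath Z J ω))) P := by
  obtain ⟨R, hR0, hR⟩ := h.exists_norm_batchError_le (γ := γ) (B := B) (x₀ := x₀) hM k
  obtain ⟨C, hC⟩ := h.exists_bound_comp_iterate (γ := γ) (B := B) (x₀ := x₀) hM
    h.continuous_mean k
  have hX := measurable_randGDIterate (γ := γ) (B := B) (M := M) (x₀ := x₀) h.measurable_field k
  refine integrable_of_measurable_of_norm_le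
    (((h.continuous_mean.measurable.comp hX).neg.inner (h.measurable_batchError k i)).comp
      h.measurable_samplePath) (C * R) fun ω => ?_
  refine (norm_inner_le_norm _ _).trans ?_
  rw [norm_neg]
  exact mul_le_mul (hC _ _) (hR i _) (norm_nonneg _)
    ((norm_nonneg _).trans (hC (samplePath Z J ω).1 fun _ => 0))

/-- Mean squared error of the randomized estimator. -/
theorem integral_norm_randBatchError_sq_le (h : IsMarkovModel P Q π τ Z J G g r) (hM : 0 ≤ M)
    (hB : 0 < B) {K : ℕ} (hK1 : 1 ≤ K) (hK : (2 : ℝ) ^ K ≤ M) (hK' : M < 2 ^ (K + 1)) (k : ℕ) :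
    ∫ ω, ‖randBatchError G g γ B M x₀ k (J k ω) (samplePath Z J ω)‖ ^ 2 ∂P
      ≤ 224 / 3 * τ * (K / B) * ∫ ω, r (randGDIterate G γ B M x₀ (samplePath Z J ω).1
        (samplePath Z J ω).2 k) ^ 2 ∂P := by
  obtain ⟨R, hR0, hR⟩ := h.exists_norm_randBatchError_le (γ := γ) (B := B) (x₀ := x₀) hM k
  have havg := h.sampling.integral_level h.chain.measurable k K
    (H := fun i p => ‖randBatchError G g γ B M x₀ k i p‖ ^ 2)
    (fun i => (h.measurable_randBatchError k i).norm.pow_const 2) (R := R ^ 2)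
    (fun i p => by
      rw [norm_pow, norm_norm]
      exact pow_le_pow_left₀ (norm_nonneg _) (hR i p) 2)
    (fun i z j => by rw [randBatchError_truncSeq])
    (fun i p hi => by
      rw [randBatchError_of_lt k (hK'.trans_le (pow_le_pow_right₀ one_le_two hi)) p])
  set I := ∫ ω, r (randGDIterate G γ B M x₀ (samplePath Z J ω).1 (samplePath Z J ω).2 k) ^ 2 ∂P
    with hI
  have hI0 : 0 ≤ I := integral_nonneg fun ω => sq_nonneg _
  set m := 16 / 3 * τ / B * I with hm
  have hB' : (0 : ℝ) < B := by exact_mod_cast hB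
  have hm0 : 0 ≤ m := by positivity
  have hmse : ∀ i, ∫ ω, ‖batchError G g γ B M x₀ k i (samplePath Z J ω)‖ ^ 2 ∂P
      ≤ (1 / 2) ^ i * m := fun i => by
    refine (h.integral_norm_batchError_sq_le hM hB k i).trans (le_of_eq ?_)
    rw [hm, ← hI, one_div, inv_pow]
    field_simp
  set V : ℕ → ℝ := fun i => ∫ ω, ‖randBatchError G g γ B M x₀ k i (samplePath Z J ω)‖ ^ 2 ∂P
    with hV
  have hV0 : V 0 ≤ m := by
    simp only [hV, randBatchError_zero]
    simpa using hmse 0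
  -- The correction at level `i` costs `4 · 4^i (2^{-i} + 2^{-(i-1)}) m = 12 · 2^i m`, and the
  -- probability `2^{-i}` leaves `12 m` at every level.
  have hVi : ∀ i ∈ Finset.Icc 1 K, (1 / 2) ^ i * V i ≤ ((1 / 2) ^ i * 2 + 12) * m := by
    intro i hi
    obtain ⟨hi1, hiK⟩ := Finset.mem_Icc.1 hi
    obtain ⟨l, rfl⟩ : ∃ l, i = l + 1 := ⟨i - 1, by omega⟩
    have hiM : (2 : ℝ) ^ (l + 1) ≤ M := (pow_le_pow_right₀ one_le_two hiK).trans hK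
    have hint := fun i => h.integrable_norm_batchError_sq (γ := γ) (B := B) (x₀ := x₀) hM k i
    have h1 : V (l + 1) ≤ 2 * ((1 / 2) ^ 0 * m) + 4 * ((2 : ℝ) ^ (l + 1)) ^ 2 *
        ((1 / 2) ^ (l + 1) * m + (1 / 2) ^ l * m) := by
      have h2 : V (l + 1) ≤ ∫ ω, (2 * ‖batchError G g γ B M x₀ k 0 (samplePath Z J ω)‖ ^ 2
          + 4 * ((2 : ℝ) ^ (l + 1)) ^ 2 *
          (‖batchError G g γ B M x₀ k (l + 1) (samplePath Z J ω)‖ ^ 2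
            + ‖batchError G g γ B M x₀ k l (samplePath Z J ω)‖ ^ 2)) ∂P := by
        refine integral_mono_of_nonneg (Filter.Eventually.of_forall fun ω => sq_nonneg _)
          (((hint 0).const_mul 2).add (((hint (l + 1)).add (hint l)).const_mul _))
          (Filter.Eventually.of_forall fun ω => ?_)
        simp only [randBatchError_of_le k hiM]
        exact norm_add_smul_sub_sq_le _ _ _ _
      rw [integral_mul_add_mul_add (hint 0) (hint (l + 1)) (hint l)] at h2
      refine h2.trans ?_
      gcongr
      · exact hmse 0
      · exact hmse (l + 1)
      · exact hmse l
    refine (mul_le_mul_of_nonneg_left h1 (by positivity)).trans (le_of_eq ?_)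
    have e : (1 / 2 : ℝ) ^ l = (2 ^ l)⁻¹ := by rw [one_div, inv_pow]
    simp only [pow_succ _ l, e, pow_zero]
    field_simp
    ring
  have hsum : V 0 + ∑ i ∈ Finset.Icc 1 K, (1 / 2) ^ i * (V i - V 0) ≤ (2 + 12 * K) * m := by
    have e1 : V 0 + ∑ i ∈ Finset.Icc 1 K, (1 / 2) ^ i * (V i - V 0)
        = (1 / 2) ^ K * V 0 + ∑ i ∈ Finset.Icc 1 K, (1 / 2) ^ i * V i := by
      simp only [mul_sub, Finset.sum_sub_distrib, ← Finset.sum_mul, sum_Icc_half_pow]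
      ring
    have e2 : ∑ i ∈ Finset.Icc 1 K, ((1 / 2 : ℝ) ^ i * 2 + 12) * m
        = ((1 - (1 / 2) ^ K) * 2 + 12 * K) * m := by
      rw [← Finset.sum_mul, Finset.sum_add_distrib, ← Finset.sum_mul, sum_Icc_half_pow]
      simp [mul_comm]
    have e3 := Finset.sum_le_sum hVi
    have hp : (0 : ℝ) ≤ (1 / 2) ^ K := by positivity
    rw [e1]
    nlinarith [mul_le_mul_of_nonneg_left hV0 hp, mul_nonneg hp hm0]
  refine (havg.trans_le hsum).trans ?_
  have hK1' : (1 : ℝ) ≤ K := by exact_mod_cast hK1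
  calc (2 + 12 * K) * m ≤ 14 * K * m := mul_le_mul_of_nonneg_right (by linarith) hm0
    _ = _ := by rw [hm]; ring

/-- The randomized estimator has the bias of the batch mean at the truncation level. -/
theorem integral_inner_randBatchError_eq (h : IsMarkovModel P Q π τ Z J G g r) (hM : 0 ≤ M)
    {K : ℕ} (hK : (2 : ℝ) ^ K ≤ M) (hK' : M < 2 ^ (K + 1)) (k : ℕ) :
    ∫ ω, inner ℝ (-g (randGDIterate G γ B M x₀ (samplePath Z J ω).1 (samplePath Z J ω).2 k))
        (randBatchError G g γ B M x₀ k (J k ω) (samplePath Z J ω)) ∂P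
      = ∫ ω, inner ℝ (-g (randGDIterate G γ B M x₀ (samplePath Z J ω).1 (samplePath Z J ω).2 k))
        (batchError G g γ B M x₀ k K (samplePath Z J ω)) ∂P := by
  obtain ⟨R, hR0, hR⟩ := h.exists_norm_randBatchError_le (γ := γ) (B := B) (x₀ := x₀) hM k
  obtain ⟨C, hC⟩ := h.exists_bound_comp_iterate (γ := γ) (B := B) (x₀ := x₀) hM
    h.continuous_mean k
  have hX := measurable_randGDIterate (γ := γ) (B := B) (M := M) (x₀ := x₀) h.measurable_field k
  have havg := h.sampling.integral_level h.chain.measurable k K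
    (H := fun i p => inner ℝ (-g (randGDIterate G γ B M x₀ p.1 p.2 k))
      (randBatchError G g γ B M x₀ k i p))
    (fun i => (h.continuous_mean.measurable.comp hX).neg.inner (h.measurable_randBatchError k i))
    (R := C * R)
    (fun i p => by
      refine (norm_inner_le_norm _ _).trans ?_
      rw [norm_neg]
      exact mul_le_mul (hC _ _) (hR i _) (norm_nonneg _)
        ((norm_nonneg _).trans (hC p.1 fun _ => 0)))
    (fun i z j => by rw [randBatchError_truncSeq, randGDIterate_truncSeq])
    (fun i p hi => by
      rw [randBatchError_of_lt k (hK'.trans_le (pow_le_pow_right₀ one_le_two hi)) p])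
  set a : ℕ → ℝ := fun i => ∫ ω, inner ℝ
    (-g (randGDIterate G γ B M x₀ (samplePath Z J ω).1 (samplePath Z J ω).2 k))
    (batchError G g γ B M x₀ k i (samplePath Z J ω)) ∂P with ha
  set b : ℕ → ℝ := fun i => ∫ ω, inner ℝ
    (-g (randGDIterate G γ B M x₀ (samplePath Z J ω).1 (samplePath Z J ω).2 k))
    (randBatchError G g γ B M x₀ k i (samplePath Z J ω)) ∂P with hb
  have hb0 : b 0 = a 0 := by simp only [hb, ha, randBatchError_zero]
  have hint := fun i => h.integrable_inner_batchError (γ := γ) (B := B) (x₀ := x₀) hM k i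
  -- The weight `2^{-i}` cancels the factor `2^i` in `b i - b 0 = 2^i (a i - a (i - 1))`, and the
  -- sum telescopes from the base batch to level `n`.
  have hbi : ∀ n ≤ K, b 0 + ∑ i ∈ Finset.Icc 1 n, (1 / 2) ^ i * (b i - b 0) = a n := by
    intro n hn
    induction n with
    | zero => simp [hb0]
    | succ l ih =>
      have hiM : (2 : ℝ) ^ (l + 1) ≤ M := (pow_le_pow_right₀ one_le_two hn).trans hK
      have h1 : b (l + 1) = a 0 + 2 ^ (l + 1) * (a (l + 1) - a l) := by
        simp only [hb, ha, randBatchError_of_le k hiM, inner_add_right, inner_smul_right,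
          inner_sub_right]
        exact integral_add_mul_sub (hint 0) (hint (l + 1)) (hint l) _
      rw [Finset.sum_Icc_succ_top (by omega), ← add_assoc, ih (by omega), h1, hb0,
        add_sub_cancel_left, ← mul_assoc, ← mul_pow]
      norm_num
  exact havg.trans (hbi K le_rfl)

end IsMarkovModel

end Step

/-! ### Expected descent and summation over the iterations -/

section Convergence

variable {d : ℕ} {S Ω : Type*} [MeasurableSpace S] [MeasurableSpace Ω]
  {γ : ℝ} {B : ℕ} {M : ℝ} {x₀ : EuclideanSpace ℝ (Fin d)}
  {P : Measure Ω} {Q : Kernel S S} [IsMarkovKernel Q]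
  {π : Measure S} {τ : ℕ} {Z : ℕ → Ω → S} {J : ℕ → Ω → ℕ}

/-- A Lipschitz mean grows at most linearly, hence so do the noise level and the whole field. The
bounded deviation also makes `G x` integrable, which is needed to split its integral and obtain
centering. -/
theorem isMarkovModel_of_lipschitz_of_noise_bound
    {G : EuclideanSpace ℝ (Fin d) → S → EuclideanSpace ℝ (Fin d)}
    {g : EuclideanSpace ℝ (Fin d) → EuclideanSpace ℝ (Fin d)} {L σ δ : ℝ} (hL : 0 ≤ L)
    (hgc : Continuous g) (hg : ∀ x y, ‖g x - g y‖ ≤ L * ‖x - y‖) (hπ : IsUniqueInvariant Q π)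
    (hQ : HasMixingTime Q τ) (hZ : IsMarkovChain P Q π Z) (hJ : IsGeometricSampling P Z J)
    (hG : Measurable fun p : EuclideanSpace ℝ (Fin d) × S => G p.1 p.2)
    (hmean : ∀ x, ∫ z, G x z ∂π = g x)
    (hnoise : ∀ x z, ‖G x z - g x‖ ^ 2 ≤ σ ^ 2 + δ ^ 2 * ‖g x‖ ^ 2) :
    IsMarkovModel P Q π τ Z J G g (fun x => √(σ ^ 2 + δ ^ 2 * ‖g x‖ ^ 2)) := by
  have := hπ.isProbabilityMeasure
  have hle : ∀ x z, ‖deviation G g x z‖ ≤ √(σ ^ 2 + δ ^ 2 * ‖g x‖ ^ 2) := fun x z =>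
    Real.le_sqrt_of_sq_le (hnoise x z)
  have hdm : Measurable fun p : EuclideanSpace ℝ (Fin d) × S => deviation G g p.1 p.2 :=
    hG.sub (hgc.measurable.comp measurable_fst)
  have hrc : Continuous fun x => √(σ ^ 2 + δ ^ 2 * ‖g x‖ ^ 2) := by
    fun_prop
  refine ⟨hJ, hZ, hπ.isProbabilityMeasure, hπ.invariant, hQ,
    ⟨hdm, hrc.measurable, hle, fun x => ?_⟩, hG, hgc, hrc, ?_⟩
  · have hdx : Measurable (deviation G g x) := hdm.comp measurable_prodMk_left
    have hd : Integrable (deviation G g x) π := integrable_of_measurable_of_norm_le hdx _ (hle x)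
    have hs : Integrable (G x) π := by
      refine (hd.add (integrable_const (g x))).congr (Filter.Eventually.of_forall fun z => ?_)
      simp [deviation]
    simp only [deviation]
    rw [integral_sub hs (integrable_const _), hmean]
    simp
  · refine ⟨|σ| + (|δ| + 1) * ‖g 0‖, (|δ| + 1) * L, by positivity, fun x z => ?_⟩
    have h1 : ‖g x‖ ≤ ‖g 0‖ + L * ‖x‖ := by
      have h2 := hg x 0
      rw [sub_zero] at h2
      linarith [norm_le_norm_add_norm_sub' (g x) (g 0)]
    have h3 : √(σ ^ 2 + δ ^ 2 * ‖g x‖ ^ 2) ≤ |σ| + |δ| * ‖g x‖ := by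
      refine Real.sqrt_le_iff.2 ⟨by positivity, ?_⟩
      rw [add_sq, sq_abs, mul_pow, sq_abs]
      have : 0 ≤ 2 * |σ| * (|δ| * ‖g x‖) := by positivity
      linarith
    have h4 := hle x z
    have h5 := norm_le_norm_add_norm_sub' (G x z) (g x)
    have h6 := mul_le_mul_of_nonneg_left h1 (show 0 ≤ |δ| + 1 by positivity)
    simp only [deviation] at h4
    linarith

variable [IsProbabilityMeasure P]

/-- Descent in expectation in one step of the method. -/
theorem IsMarkovModel.integral_iterate_succ_le
    {G : EuclideanSpace ℝ (Fin d) → S → EuclideanSpace ℝ (Fin d)}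
    {f : EuclideanSpace ℝ (Fin d) → ℝ} {r : EuclideanSpace ℝ (Fin d) → ℝ} {L : ℝ} (hL : 0 ≤ L)
    (hγ : 0 ≤ γ) (hf : LSmooth L f) (h : IsMarkovModel P Q π τ Z J G (gradient f) r)
    (hM : 0 ≤ M) (hB : 0 < B) {K : ℕ} (hK1 : 1 ≤ K) (hK : (2 : ℝ) ^ K ≤ M)
    (hK' : M < 2 ^ (K + 1)) (k : ℕ) :
    ∫ ω, f (randGDIterate G γ B M x₀ (samplePath Z J ω).1 (samplePath Z J ω).2 (k + 1)) ∂P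
      ≤ ∫ ω, f (randGDIterate G γ B M x₀ (samplePath Z J ω).1 (samplePath Z J ω).2 k) ∂P
        - (γ / 2 - L * γ ^ 2) * ∫ ω, ‖gradient f (randGDIterate G γ B M x₀ (samplePath Z J ω).1
          (samplePath Z J ω).2 k)‖ ^ 2 ∂P
        + (γ / 2 * (8 / 3 * τ / (2 ^ K * B)) ^ 2 + L * γ ^ 2 * (224 / 3 * τ * (K / B))) *
          ∫ ω, r (randGDIterate G γ B M x₀ (samplePath Z J ω).1 (samplePath Z J ω).2 k) ^ 2 ∂P := by
  set X : ℕ → Ω → EuclideanSpace ℝ (Fin d) := fun k ω =>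
    randGDIterate G γ B M x₀ (samplePath Z J ω).1 (samplePath Z J ω).2 k with hX
  set D : Ω → EuclideanSpace ℝ (Fin d) := fun ω =>
    randBatchError G (gradient f) γ B M x₀ k (J k ω) (samplePath Z J ω) with hD
  set c : ℝ := 8 / 3 * τ / (2 ^ K * B) with hc
  have hgc := hf.continuous_gradient
  have hfi : ∀ k, Integrable (fun ω => f (X k ω)) P := fun k =>
    h.integrable_comp_iterate hM hf.1.continuous k
  have hgi : Integrable (fun ω => ‖gradient f (X k ω)‖ ^ 2) P :=
    h.integrable_comp_iterate hM (φ := fun x => ‖gradient f x‖ ^ 2) (hgc.norm.pow 2) k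
  have hri : Integrable (fun ω => r (X k ω) ^ 2) P :=
    h.integrable_comp_iterate hM (φ := fun x => r x ^ 2) (h.continuous_bound.pow 2) k
  have hXm : Measurable (X k) :=
    (measurable_randGDIterate h.measurable_field k).comp h.measurable_samplePath
  have hDm : Measurable D :=
    measurable_apply_level (φ := fun i ω =>
      randBatchError G (gradient f) γ B M x₀ k i (samplePath Z J ω))
      (fun i => (h.measurable_randBatchError k i).comp h.measurable_samplePath)
      (h.sampling.measurable k)
  obtain ⟨R, hR0, hR⟩ := h.exists_norm_randBatchError_le (γ := γ) (B := B) (x₀ := x₀) hM k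
  have hDi : Integrable (fun ω => ‖D ω‖ ^ 2) P := by
    refine integrable_of_measurable_of_norm_le (hDm.norm.pow_const 2) (R ^ 2) fun ω => ?_
    rw [norm_pow, norm_norm]
    exact pow_le_pow_left₀ (norm_nonneg _) (hR _ _) 2
  have hDgi : Integrable (fun ω => inner ℝ (-gradient f (X k ω)) (D ω)) P := by
    obtain ⟨C, hC⟩ := h.exists_bound_comp_iterate (γ := γ) (B := B) (x₀ := x₀) hM hgc k
    refine integrable_of_measurable_of_norm_le
      ((hgc.measurable.comp hXm).neg.inner hDm) (C * R) fun ω => ?_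
    refine (norm_inner_le_norm _ _).trans ?_
    rw [norm_neg]
    exact mul_le_mul (hC _ _) (hR _ _) (norm_nonneg _)
      ((norm_nonneg _).trans (hC (samplePath Z J ω).1 fun _ => 0))
  -- The cross term with the error `D` is kept as an inner product: its expectation sees only the
  -- small bias, whereas a pointwise bound would pay for the full second moment at order `γ`.
  have hstep : ∀ ω, f (X (k + 1) ω) ≤ f (X k ω) - γ * ‖gradient f (X k ω)‖ ^ 2
      + γ * inner ℝ (-gradient f (X k ω)) (D ω)
      + L * γ ^ 2 * (‖gradient f (X k ω)‖ ^ 2 + ‖D ω‖ ^ 2) := by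
    intro ω
    have hx : X (k + 1) ω = X k ω + -(γ • (gradient f (X k ω) + D ω)) := by
      rw [← sub_eq_add_neg]
      simp only [hX, hD]
      rw [randGDIterate_succ, randBatchGrad_eq_add_deviation (g := gradient f) hB]
      rfl
    rw [hx]
    refine (hf.le_add_inner_add_sq _ _).trans ?_
    rw [inner_neg_right, inner_smul_right, inner_add_right, real_inner_self_eq_norm_sq, norm_neg,
      norm_smul, Real.norm_of_nonneg hγ, inner_neg_left, mul_pow]
    have h1 : ‖gradient f (X k ω) + D ω‖ ^ 2
        ≤ 2 * (‖gradient f (X k ω)‖ ^ 2 + ‖D ω‖ ^ 2) := by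
      have h2 := pow_le_pow_left₀ (norm_nonneg _) (norm_add_le (gradient f (X k ω)) (D ω)) 2
      nlinarith [sq_nonneg (‖gradient f (X k ω)‖ - ‖D ω‖)]
    have h3 := mul_le_mul_of_nonneg_left h1 (show 0 ≤ L / 2 * γ ^ 2 by positivity)
    linarith
  have hmono := integral_mono (hfi (k + 1)) ((((hfi k).sub (hgi.const_mul γ)).add
    (hDgi.const_mul γ)).add ((hgi.add hDi).const_mul (L * γ ^ 2))) hstep
  have hsplit : ∫ ω, (f (X k ω) - γ * ‖gradient f (X k ω)‖ ^ 2
      + γ * inner ℝ (-gradient f (X k ω)) (D ω)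
      + L * γ ^ 2 * (‖gradient f (X k ω)‖ ^ 2 + ‖D ω‖ ^ 2)) ∂P
      = ∫ ω, f (X k ω) ∂P - γ * ∫ ω, ‖gradient f (X k ω)‖ ^ 2 ∂P
        + γ * ∫ ω, inner ℝ (-gradient f (X k ω)) (D ω) ∂P
        + L * γ ^ 2 * (∫ ω, ‖gradient f (X k ω)‖ ^ 2 ∂P + ∫ ω, ‖D ω‖ ^ 2 ∂P) := by
    have i1 : Integrable (fun ω => f (X k ω) - γ * ‖gradient f (X k ω)‖ ^ 2) P :=
      (hfi k).sub (hgi.const_mul γ)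
    have i2 : Integrable (fun ω => f (X k ω) - γ * ‖gradient f (X k ω)‖ ^ 2
      + γ * inner ℝ (-gradient f (X k ω)) (D ω)) P := i1.add (hDgi.const_mul γ)
    have i3 : Integrable (fun ω => ‖gradient f (X k ω)‖ ^ 2 + ‖D ω‖ ^ 2) P := hgi.add hDi
    rw [integral_add i2 (i3.const_mul _), integral_add i1 (hDgi.const_mul γ),
      integral_sub (hfi k) (hgi.const_mul γ), integral_const_mul, integral_const_mul,
      integral_const_mul, integral_add hgi hDi]
  have hvar : ∫ ω, ‖D ω‖ ^ 2 ∂P ≤ 224 / 3 * τ * (K / B) * ∫ ω, r (X k ω) ^ 2 ∂P :=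
    h.integral_norm_randBatchError_sq_le hM hB hK1 hK hK' k
  -- Young's inequality spends half of the decrease `γ‖∇f‖²` so that the bias coefficient `c`
  -- appears squared.
  have hbias : ∫ ω, inner ℝ (-gradient f (X k ω)) (D ω) ∂P
      ≤ 1 / 2 * ∫ ω, ‖gradient f (X k ω)‖ ^ 2 ∂P + c ^ 2 / 2 * ∫ ω, r (X k ω) ^ 2 ∂P := by
    refine (h.integral_inner_randBatchError_eq hM hK hK' k).trans_le
      ((h.integral_inner_batchError_le hM hB k K).trans ?_)
    rw [← hc, ← integral_const_mul, ← integral_const_mul, ← integral_const_mul,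
      ← integral_add (hgi.const_mul _) (hri.const_mul _)]
    refine integral_mono ?_ ((hgi.const_mul _).add (hri.const_mul _)) fun ω => ?_
    · exact h.integrable_comp_iterate hM (φ := fun x => c * (‖gradient f x‖ * r x))
        (continuous_const.mul (hgc.norm.mul h.continuous_bound)) k
    · change c * (‖gradient f (X k ω)‖ * r (X k ω))
        ≤ 1 / 2 * ‖gradient f (X k ω)‖ ^ 2 + c ^ 2 / 2 * r (X k ω) ^ 2
      nlinarith [sq_nonneg (‖gradient f (X k ω)‖ - c * r (X k ω))]
  have hmono' := hmono.trans_eq hsplit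
  have e1 := mul_le_mul_of_nonneg_left hvar (show 0 ≤ L * γ ^ 2 by positivity)
  have e2 := mul_le_mul_of_nonneg_left hbias hγ
  change ∫ ω, f (X (k + 1) ω) ∂P ≤ ∫ ω, f (X k ω) ∂P
    - (γ / 2 - L * γ ^ 2) * ∫ ω, ‖gradient f (X k ω)‖ ^ 2 ∂P
    + (γ / 2 * c ^ 2 + L * γ ^ 2 * (224 / 3 * τ * (K / B))) * ∫ ω, r (X k ω) ^ 2 ∂P
  linarith

/-- The level `K = ⌊log₂ M⌋` is the last one used by the estimator. The final inequality is what
makes the second moment, proportional to `K / B`, independent of the number of levels. -/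
theorem exists_truncation_level (b : ℕ) (hM : 2 ≤ M) :
    ∃ K : ℕ, 1 ≤ K ∧ (2 : ℝ) ^ K ≤ M ∧ M < 2 ^ (K + 1) ∧
      (b : ℝ) * K ≤ (⌈(b : ℝ) * Real.logb 2 M⌉₊ : ℝ) := by
  have hM0 : 0 < M := by linarith
  have hM1 : ⌊M⌋₊ ≠ 0 := (Nat.floor_pos.2 (by linarith)).ne'
  have hK : (2 : ℝ) ^ Nat.log 2 ⌊M⌋₊ ≤ M := by
    refine le_trans ?_ (Nat.floor_le hM0.le)
    exact_mod_cast Nat.pow_log_le_self 2 hM1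
  have hK' : M < 2 ^ (Nat.log 2 ⌊M⌋₊ + 1) := by
    have h1 := Nat.lt_pow_succ_log_self one_lt_two ⌊M⌋₊
    have h2 := (Nat.floor_lt hM0.le).1 h1
    exact_mod_cast h2
  refine ⟨Nat.log 2 ⌊M⌋₊, ?_, hK, hK', ?_⟩
  · by_contra hlt
    rw [show Nat.log 2 ⌊M⌋₊ = 0 by omega] at hK'
    norm_num at hK'
    linarith
  · refine le_trans (mul_le_mul_of_nonneg_left ?_ (Nat.cast_nonneg b)) (Nat.le_ceil _)
    rw [Real.le_logb_iff_rpow_le one_lt_two hM0, Real.rpow_natCast]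
    exact hK

/-- Convergence of the randomized-batch method under explicit smallness conditions. -/
theorem integral_avgSqGrad_le {F : EuclideanSpace ℝ (Fin d) → S → ℝ} {L σ δ fstar : ℝ}
    {N b : ℕ} {A : ℝ} (hL : 0 < L) (hf : LSmooth L (objective π F)) (hπ : IsUniqueInvariant Q π)
    (hQ : HasMixingTime Q τ) (hZ : IsMarkovChain P Q π Z) (hF : IsGradientOracle π F σ δ)
    (hJ : IsGeometricSampling P Z J) (hmin : IsLeast (Set.range (objective π F)) fstar)
    (hN : 1 ≤ N) (hb : 1 ≤ b) (hγ : 0 < γ) (hM : 2 ≤ M) (hA : 0 ≤ A)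
    (hMA : 1 ≤ A * (γ * L) * M ^ 2)
    (hsmall : L * γ * (1 + (75 * τ / b + 15 * A * τ ^ 2 / b ^ 2) * δ ^ 2) ≤ 3 / 8) :
    Integrable (avgSqGrad π F Z J γ b M x₀ N) P ∧
      ∫ ω, avgSqGrad π F Z J γ b M x₀ N ω ∂P ≤
        (8 * (75 + 15 * A)) * ((objective π F x₀ - fstar) / (γ * N)
          + L * γ * (σ ^ 2 * τ / b + σ ^ 2 * τ ^ 2 / b ^ 2)) := by
  obtain ⟨K, hK1, hK, hK', hKB⟩ := exists_truncation_level b hM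
  set B := ⌈(b : ℝ) * Real.logb 2 M⌉₊ with hBdef
  have hM0 : 0 < M := by linarith
  have hb' : (1 : ℝ) ≤ b := by exact_mod_cast hb
  have hb0 : (0 : ℝ) < b := by linarith
  have hK1' : (1 : ℝ) ≤ K := by exact_mod_cast hK1
  have hbB : (b : ℝ) ≤ B := (le_mul_of_one_le_right hb0.le hK1').trans hKB
  have hB' : (0 : ℝ) < B := by linarith
  have hB : 0 < B := by exact_mod_cast hB'
  have hN' : (0 : ℝ) < N := by exact_mod_cast hN
  have hmodel := isMarkovModel_of_lipschitz_of_noise_bound hL.le hf.continuous_gradient hf.2 hπ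
    hQ hZ hJ hF.measurable_grad hF.unbiased hF.noise_bound
  set f := objective π F with hfdef
  set X : ℕ → Ω → EuclideanSpace ℝ (Fin d) := fun k ω =>
    randGDIterate (stochGrad F) γ B M x₀ (samplePath Z J ω).1 (samplePath Z J ω).2 k with hX
  have hgi : ∀ k, Integrable (fun ω => ‖gradient f (X k ω)‖ ^ 2) P := fun k =>
    hmodel.integrable_comp_iterate hM0.le (φ := fun x => ‖gradient f x‖ ^ 2)
      (hf.continuous_gradient.norm.pow 2) k
  have hfi : ∀ k, Integrable (fun ω => f (X k ω)) P := fun k =>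
    hmodel.integrable_comp_iterate hM0.le hf.1.continuous k
  set q : ℕ → ℝ := fun k => ∫ ω, ‖gradient f (X k ω)‖ ^ 2 ∂P with hq
  have hq0 : ∀ k, 0 ≤ q k := fun k => integral_nonneg fun ω => sq_nonneg _
  set w : ℝ := 75 * τ / b + 15 * A * τ ^ 2 / b ^ 2 with hw
  have hr : ∀ k, ∫ ω, √(σ ^ 2 + δ ^ 2 * ‖gradient f (X k ω)‖ ^ 2) ^ 2 ∂P
      = σ ^ 2 + δ ^ 2 * q k := fun k => by
    have : ∀ ω, √(σ ^ 2 + δ ^ 2 * ‖gradient f (X k ω)‖ ^ 2) ^ 2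
        = σ ^ 2 + δ ^ 2 * ‖gradient f (X k ω)‖ ^ 2 := fun ω => Real.sq_sqrt (by positivity)
    simp only [this]
    rw [integral_add (integrable_const _) ((hgi k).const_mul _), integral_const_mul]
    simp [hq]
  -- Since `M < 2^{K+1}`, the condition on `A` gives `(2^K B)^{-2} ≤ 4AγL/b²`, so the squared bias
  -- gains the factor `Lγ`. The constants `75` and `15` round up `224/3` and `128/9`.
  have hcoef : γ / 2 * (8 / 3 * τ / (2 ^ K * B)) ^ 2 + L * γ ^ 2 * (224 / 3 * τ * (K / B))
      ≤ L * γ ^ 2 * w := by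
    have h1 : (K : ℝ) / B ≤ 1 / b := by
      rw [div_le_div_iff₀ hB' hb0]
      linarith
    have h2 : (1 : ℝ) / (2 ^ K * B) ^ 2 ≤ 4 * (A * (γ * L)) / b ^ 2 := by
      rw [div_le_div_iff₀ (by positivity) (by positivity), one_mul]
      have h3 : M ^ 2 ≤ 4 * (2 ^ K) ^ 2 := by
        rw [pow_succ] at hK'
        have := pow_le_pow_left₀ hM0.le hK'.le 2
        linarith
      have h4 : (b : ℝ) ^ 2 ≤ B ^ 2 := pow_le_pow_left₀ hb0.le hbB 2
      have h5 : 0 ≤ A * (γ * L) := by positivity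
      have h6 : 1 ≤ A * (γ * L) * (4 * (2 ^ K) ^ 2) :=
        hMA.trans (mul_le_mul_of_nonneg_left h3 h5)
      calc (b : ℝ) ^ 2 ≤ B ^ 2 := h4
        _ ≤ (A * (γ * L) * (4 * (2 ^ K) ^ 2)) * B ^ 2 :=
          le_mul_of_one_le_left (by positivity) h6
        _ = _ := by ring
    have h7 : (8 / 3 * τ / (2 ^ K * B) : ℝ) ^ 2 = 64 / 9 * τ ^ 2 * (1 / (2 ^ K * B) ^ 2) := by
      ring
    rw [h7]
    calc γ / 2 * (64 / 9 * τ ^ 2 * (1 / (2 ^ K * B) ^ 2))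
          + L * γ ^ 2 * (224 / 3 * τ * (K / B))
        ≤ γ / 2 * (64 / 9 * τ ^ 2 * (4 * (A * (γ * L)) / b ^ 2))
          + L * γ ^ 2 * (224 / 3 * τ * (1 / b)) := by gcongr
      _ = L * γ ^ 2 * (224 / 3 * (τ / b) + 128 / 9 * (A * τ ^ 2 / b ^ 2)) := by ring
      _ ≤ L * γ ^ 2 * (75 * (τ / b) + 15 * (A * τ ^ 2 / b ^ 2)) := by
          gcongr <;> norm_num
      _ = L * γ ^ 2 * w := by rw [hw]; ring
  -- The smallness condition bounds `Lγ² (1 + w δ²)` by `3γ/8`, leaving `γ/2 - 3γ/8 = γ/8` of the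
  -- decrease.
  have hstep : ∀ k, ∫ ω, f (X (k + 1) ω) ∂P
      ≤ ∫ ω, f (X k ω) ∂P - γ / 8 * q k + L * γ ^ 2 * w * σ ^ 2 := by
    intro k
    have h1 := hmodel.integral_iterate_succ_le (x₀ := x₀) hL.le hγ.le hf hM0.le hB hK1 hK hK' k
    have h2 : 0 ≤ σ ^ 2 + δ ^ 2 * q k := by have := hq0 k; positivity
    have h3 := mul_le_mul_of_nonneg_right hcoef h2
    have h4 := mul_le_mul_of_nonneg_left hsmall (mul_nonneg hγ.le (hq0 k))
    change ∫ ω, f (X (k + 1) ω) ∂P ≤ ∫ ω, f (X k ω) ∂P - (γ / 2 - L * γ ^ 2) * q k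
      + (γ / 2 * (8 / 3 * τ / (2 ^ K * B)) ^ 2 + L * γ ^ 2 * (224 / 3 * τ * (K / B))) *
        ∫ ω, √(σ ^ 2 + δ ^ 2 * ‖gradient f (X k ω)‖ ^ 2) ^ 2 ∂P at h1
    rw [hr k] at h1
    nlinarith
  have hsum : ∀ n : ℕ, γ / 8 * ∑ k ∈ Finset.range n, q k + ∫ ω, f (X n ω) ∂P
      ≤ f x₀ + n * (L * γ ^ 2 * w * σ ^ 2) := by
    intro n
    induction n with
    | zero =>
      have : ∀ ω, X 0 ω = x₀ := fun ω => rfl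
      simp [this]
    | succ n ih =>
      rw [Finset.sum_range_succ]
      push_cast
      linarith [hstep n]
  have hlow : fstar ≤ ∫ ω, f (X N ω) ∂P := by
    have h1 : ∫ _, fstar ∂P ≤ ∫ ω, f (X N ω) ∂P :=
      integral_mono (integrable_const _) (hfi N) fun ω => hmin.2 ⟨_, rfl⟩
    simpa using h1
  have havg : avgSqGrad π F Z J γ b M x₀ N
      = fun ω => (N : ℝ)⁻¹ * ∑ k ∈ Finset.range N, ‖gradient f (X k ω)‖ ^ 2 := rfl
  have hsi : Integrable (fun ω => ∑ k ∈ Finset.range N, ‖gradient f (X k ω)‖ ^ 2) P :=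
    integrable_finsetSum _ fun k _ => hgi k
  rw [havg]
  refine ⟨hsi.const_mul _, ?_⟩
  rw [integral_const_mul, integral_finsetSum _ fun k _ => hgi k]
  have h1 := hsum N
  have hgap : 0 ≤ f x₀ - fstar := sub_nonneg.2 (hmin.2 ⟨x₀, rfl⟩)
  have h2 : ∑ k ∈ Finset.range N, q k
      ≤ 8 / γ * (f x₀ - fstar + N * (L * γ ^ 2 * w * σ ^ 2)) := by
    have h3 : γ / 8 * ∑ k ∈ Finset.range N, q k
      ≤ f x₀ - fstar + N * (L * γ ^ 2 * w * σ ^ 2) := by linarith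
    have h4 := mul_le_mul_of_nonneg_left h3 (show 0 ≤ 8 / γ by positivity)
    refine le_trans (le_of_eq ?_) h4
    field_simp
  have hnoise : w * σ ^ 2 ≤ (75 + 15 * A) * (σ ^ 2 * τ / b + σ ^ 2 * τ ^ 2 / b ^ 2) := by
    have h5 : 0 ≤ σ ^ 2 * (τ / b) := by positivity
    have h6 : 0 ≤ σ ^ 2 * (τ ^ 2 / b ^ 2) := by positivity
    have h7 := mul_nonneg hA h5
    calc w * σ ^ 2 = 75 * (σ ^ 2 * (τ / b)) + 15 * A * (σ ^ 2 * (τ ^ 2 / b ^ 2)) := by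
          rw [hw]; ring
      _ ≤ (75 + 15 * A) * (σ ^ 2 * (τ / b)) + (75 + 15 * A) * (σ ^ 2 * (τ ^ 2 / b ^ 2)) := by
          linarith
      _ = _ := by ring
  calc (N : ℝ)⁻¹ * ∑ k ∈ Finset.range N, q k
      ≤ (N : ℝ)⁻¹ * (8 / γ * (f x₀ - fstar + N * (L * γ ^ 2 * w * σ ^ 2))) := by gcongr
    _ = 8 * ((f x₀ - fstar) / (γ * N)) + 8 * (L * γ * (w * σ ^ 2)) := by
        field_simp
    -- The optimality gap is nonnegative, so its term may be enlarged to share one constant with the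
    -- noise term.
    _ ≤ 8 * ((75 + 15 * A) * ((f x₀ - fstar) / (γ * N)))
        + 8 * (L * γ * ((75 + 15 * A) * (σ ^ 2 * τ / b + σ ^ 2 * τ ^ 2 / b ^ 2))) := by
        gcongr 8 * ?_ + 8 * (L * γ * ?_)
        exact le_mul_of_one_le_left (by positivity) (by linarith)
    _ = _ := by ring

end Convergence

end

/-! ### The constants in the two parametrizations -/

theorem mainTheorem6 :
    -- `γ ≲ …` and `M ≃ …` up to constants: `κ` is the constant in `≃`, and `c`, `C` depend on `κ` only
    (∀ κ : ℝ, 1 ≤ κ → ∃ c > (0 : ℝ), ∃ C > (0 : ℝ),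
      ∀ (d : ℕ) (S : Type u) [MeasurableSpace S] (Ω : Type v) [MeasurableSpace Ω]
        (P : Measure Ω) [IsProbabilityMeasure P]
        (Q : Kernel S S) [IsMarkovKernel Q] (π : Measure S) (τ : ℕ)
        (Z : ℕ → Ω → S) (J : ℕ → Ω → ℕ)
        (F : EuclideanSpace ℝ (Fin d) → S → ℝ) (L σ δ fstar : ℝ)
        (x₀ : EuclideanSpace ℝ (Fin d)) (N b : ℕ) (γ M : ℝ),
        0 < L → LSmooth L (objective π F) →
        IsUniqueInvariant Q π → HasMixingTime Q τ → IsMarkovChain P Q π Z →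
        IsGradientOracle π F σ δ →
        IsGeometricSampling P Z J →
        IsLeast (Set.range (objective π F)) fstar →
        1 ≤ N → 1 ≤ b → 0 < γ →
        γ ≤ c * (L * (1 + δ ^ 2 * τ / b + δ ^ 2 * τ ^ 2 / b ^ 2))⁻¹ →
        2 ≤ M →
        κ⁻¹ * max 2 (Real.sqrt (1 / (γ * L))) ≤ M →
        M ≤ κ * max 2 (Real.sqrt (1 / (γ * L))) →
        Integrable (avgSqGrad π F Z J γ b M x₀ N) P ∧
        ∫ ω, avgSqGrad π F Z J γ b M x₀ N ω ∂P ≤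
          C * ((objective π F x₀ - fstar) / (γ * N)
            + L * γ * (σ ^ 2 * τ / b + σ ^ 2 * τ ^ 2 / b ^ 2))) ∧
    -- the same with explicit constants in the conditions on `γ` and `M`
    (∃ C > (0 : ℝ),
      ∀ (d : ℕ) (S : Type u) [MeasurableSpace S] (Ω : Type v) [MeasurableSpace Ω]
        (P : Measure Ω) [IsProbabilityMeasure P]
        (Q : Kernel S S) [IsMarkovKernel Q] (π : Measure S) (τ : ℕ)
        (Z : ℕ → Ω → S) (J : ℕ → Ω → ℕ)
        (F : EuclideanSpace ℝ (Fin d) → S → ℝ) (L σ δ fstar : ℝ)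
        (x₀ : EuclideanSpace ℝ (Fin d)) (N b : ℕ) (γ M : ℝ),
        0 < L → LSmooth L (objective π F) →
        IsUniqueInvariant Q π → HasMixingTime Q τ → IsMarkovChain P Q π Z →
        IsGradientOracle π F σ δ →
        IsGeometricSampling P Z J →
        IsLeast (Set.range (objective π F)) fstar →
        1 ≤ N → 1 ≤ b → 0 < γ →
        γ ≤ (4 * L * (1 + 4 * (constC₁ * τ / b + (constC₁ + 1) * τ ^ 2 / b ^ 2) * δ ^ 2))⁻¹ →
        M = max 2 (Real.sqrt (constC₂ / (γ * L))) →
        Integrable (avgSqGrad π F Z J γ b M x₀ N) P ∧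
        ∫ ω, avgSqGrad π F Z J γ b M x₀ N ω ∂P ≤
          C * ((objective π F x₀ - fstar) / (γ * N)
            + L * γ * (σ ^ 2 * τ / b + σ ^ 2 * τ ^ 2 / b ^ 2))) := by
  constructor
  · intro κ hκ
    have hC : (0 : ℝ) < 75 + 15 * κ ^ 2 := by positivity
    -- Here `A = κ²`: the lower bound `M ≥ κ⁻¹ √(1/(γL))` says exactly `1 ≤ κ² γL M²`. The constant
    -- `c` divides `3/8` by a number dominating all coefficients in the smallness condition.
    refine ⟨3 / 8 / (75 + 15 * κ ^ 2), by positivity, 8 * (75 + 15 * κ ^ 2), by positivity, ?_⟩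
    intro d S _ Ω _ P _ Q _ π τ Z J F L σ δ fstar x₀ N b γ M hL hf hπ hQ hZ hF hJ hmin hN hb hγ
      hγc hM hM1 _
    have hb0 : (0 : ℝ) < b := by exact_mod_cast hb
    refine integral_avgSqGrad_le hL hf hπ hQ hZ hF hJ hmin hN hb hγ hM (sq_nonneg κ) ?_ ?_
    · have h1 : √(1 / (γ * L)) ≤ κ * M := by
        have h2 := (mul_le_mul_of_nonneg_left (le_max_right 2 (√(1 / (γ * L))))
          (show 0 ≤ κ⁻¹ by positivity)).trans hM1
        rwa [inv_mul_le_iff₀ (by linarith)] at h2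
      have h3 := Real.sqrt_le_iff.1 h1
      have h4 := h3.2
      rw [div_le_iff₀ (by positivity)] at h4
      linarith
    · set x : ℝ := δ ^ 2 * τ / b with hx
      set y : ℝ := δ ^ 2 * τ ^ 2 / b ^ 2 with hy
      have hx0 : 0 ≤ x := by positivity
      have hy0 : 0 ≤ y := by positivity
      have h1 : γ * (L * (1 + x + y)) ≤ 3 / 8 / (75 + 15 * κ ^ 2) := by
        rwa [← div_eq_mul_inv, le_div_iff₀ (by positivity)] at hγc
      rw [le_div_iff₀ hC] at h1
      refine le_trans ?_ h1
      have h2 : 1 + (75 * τ / b + 15 * κ ^ 2 * τ ^ 2 / b ^ 2) * δ ^ 2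
          = 1 + 75 * x + 15 * κ ^ 2 * y := by
        rw [hx, hy]; ring
      have h3 : 1 + 75 * x + 15 * κ ^ 2 * y ≤ (1 + x + y) * (75 + 15 * κ ^ 2) := by
        nlinarith [mul_nonneg (sq_nonneg κ) hx0, sq_nonneg κ]
      rw [h2]
      refine (mul_le_mul_of_nonneg_left h3 (by positivity)).trans (le_of_eq ?_)
      ring
  -- Here `A = 1 / C₂ = 3/256`, because `M² ≥ C₂/(γL)`.
  · refine ⟨8 * (75 + 15 * (3 / 256)), by norm_num, ?_⟩
    intro d S _ Ω _ P _ Q _ π τ Z J F L σ δ fstar x₀ N b γ M hL hf hπ hQ hZ hF hJ hmin hN hb hγ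
      hγc hM
    have hb0 : (0 : ℝ) < b := by exact_mod_cast hb
    have hC₁ : 16 ≤ constC₁ := by
      have : 0 ≤ 1 / Real.log 4 ^ 2 := by positivity
      unfold constC₁
      linarith
    refine integral_avgSqGrad_le hL hf hπ hQ hZ hF hJ hmin hN hb hγ
      (hM ▸ le_max_left _ _) (by norm_num) ?_ ?_
    · have h1 : √(constC₂ / (γ * L)) ≤ M := hM ▸ le_max_right _ _
      have h2 := (Real.sqrt_le_iff.1 h1).2
      rw [div_le_iff₀ (by positivity), constC₂] at h2
      linarith
    · set x : ℝ := δ ^ 2 * τ / b with hx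
      set y : ℝ := δ ^ 2 * τ ^ 2 / b ^ 2 with hy
      have hx0 : 0 ≤ x := by positivity
      have hy0 : 0 ≤ y := by positivity
      have h1 : 1 + 4 * (constC₁ * τ / b + (constC₁ + 1) * τ ^ 2 / b ^ 2) * δ ^ 2
          = 1 + 4 * constC₁ * x + 4 * (constC₁ + 1) * y := by
        rw [hx, hy]; ring
      rw [h1] at hγc
      have h2 : 1 + 64 * x + 64 * y ≤ 1 + 4 * constC₁ * x + 4 * (constC₁ + 1) * y := by
        have := mul_le_mul_of_nonneg_right hC₁ hx0
        have := mul_le_mul_of_nonneg_right hC₁ hy0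
        linarith
      have h3 : γ * (4 * L * (1 + 4 * constC₁ * x + 4 * (constC₁ + 1) * y)) ≤ 1 := by
        have hpos : 0 < 4 * L * (1 + 4 * constC₁ * x + 4 * (constC₁ + 1) * y) :=
          mul_pos (by positivity) (by linarith)
        rwa [← one_div, le_div_iff₀ hpos] at hγc
      have h4 : L * γ * (1 + 64 * x + 64 * y) ≤ 1 / 4 := by
        have := mul_le_mul_of_nonneg_left h2 (show 0 ≤ L * γ by positivity)
        linarith
      have h5 : 1 + (75 * τ / b + 15 * (3 / 256) * τ ^ 2 / b ^ 2) * δ ^ 2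
          = 1 + 75 * x + 45 / 256 * y := by
        rw [hx, hy]; ring
      rw [h5]
      -- The factor `3/2` is what the step size leaves available, as `3/2 · 1/4 = 3/8`; the
      -- coefficient `64` is `4 · 16`, from `C₁ ≥ 16`.
      have h6 : 1 + 75 * x + 45 / 256 * y ≤ 3 / 2 * (1 + 64 * x + 64 * y) := by linarith
      have h7 := mul_le_mul_of_nonneg_left h6 (show 0 ≤ L * γ by positivity)
      linarith
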